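/- Let $(\Omega,\mathcal F,\mathbb P)$ be an atomless probability space, $I=(0,\overline\alpha)$ with $\overline\alpha\in(0,\infty]$, and let $\rho=(\rho_\beta)_{\beta\in I}$ be a class of risk measures that is decreasing in $\beta$. For a random vector $\mathbf X=(X_1,\dots,X_n)$ with $S=\sum_{i=1}^n X_i$ and for $\alpha\in I$, put $$\mathrm{DQ}^\rho_\alpha(\mathbf X)=\frac{\alpha^*}{\alpha},\qquad \alpha^*=\inf\Big\{\beta\in I:\rho_\beta(S)\le\sum_{i=1}^n\rho_\alpha(X_i)\Big\},\qquad \widetilde\alpha=\sup\Big\{\beta\in I:\rho_\beta(S)\ge\sum_{i=1}^n\rho_\alpha(X_i)\Big\},$$ with $\inf\varnothing=\overline\alpha$ and $\sup\varnothing=0$. For law-invariant $\rho$ the value $\mathrm{DQ}^\rho_\alpha(\mathbf X)$ depends only on the joint law $F$ of $\mathbf X$ and is also written $\mathrm{DQ}^\rho_\alpha(F)$. Let $\{\mathbf X^{(k)}\}_{k\ge1}$ be random vectors on $\Omega$ with the law of $\mathbf X$; the empirical estimator is $\widehat{\mathrm{DQ}^\rho_\alpha}(N)=\mathrm{DQ}^\rho_\alpha(\widehat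 F^N)$, where $\widehat F^N$ is the empirical joint distribution of $\mathbf X^{(1)},\dots,\mathbf X^{(N)}$. Suppose that $\{\mathbf X^{(k)}\}_{k\ge1}$ is (strictly) stationary and $\alpha$-mixing, i.e. its mixing coefficient $$\alpha(m)=\sup\{|\mathbb P(A\cap B)-\mathbb P(A)\mathbb P(B)|:A\in\sigma(\mathbf X^{(j)},1\le j\le k),\ B\in\sigma(\mathbf X^{(j)},j\ge k+m),\ k\ge1\}$$ tends to $0$ as $m\to\infty$, and that for some $\delta>0$ $$\sum_{m=3}^\infty m^{-1}(\log m)(\log\log m)^{1+\delta}\,\alpha(m)<\infty .$$ Let $\alpha\in I$, and suppose that either (a) each $\rho_\beta$, $\beta\in I$, is a law-invariant convex risk measure on $L^1$ (a map $L^1\to\mathbb R$ that is law-invariant, monotone, translation invariant and convex), and $X_1,\dots,X_n\in L^1$; or (b) $I=(0,1)$ and $\rho_\beta=\mathrm{VaR}_\beta$, where $\mathrm{VaR}_\beta(Y)=\inf\{x\in\mathbb R:\mathbb P(Y\le x)\ge1-\beta\}$, the quantile function of each $X_i$ is continuous at $1-\alpha$, and the quantile function of $S$ is continuous on $(0,1)$.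 Then, $\mathbb P$-almost surely, $$\liminf_{N\to\infty}\widehat{\mathrm{DQ}^\rho_\alpha}(N)\ge\mathrm{DQ}^\rho_\alpha(\mathbf X)\quad\text{and}\quad\limsup_{N\to\infty}\widehat{\mathrm{DQ}^\rho_\alpha}(N)\le\frac{\widetilde\alpha}{\alpha}.$$ If moreover $\beta\mapsto\rho_\beta(S)$ is strictly decreasing on $I$, then $\widehat{\mathrm{DQ}^\rho_\alpha}(N)\to\mathrm{DQ}^\rho_\alpha(\mathbf X)$ $\mathbb P$-almost surely, i.e. the estimator is strongly consistent. -/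

import Mathlib

open MeasureTheory ProbabilityTheory Filter Topology
open scoped ENNReal

noncomputable section

namespace DivQuot

variable {Ω : Type*} [MeasurableSpace Ω]

/-- The measure `P` is atomless: every measurable set of positive measure has a measurable subset
of strictly smaller positive measure. -/
def Atomless (P : Measure Ω) : Prop :=
  ∀ A, MeasurableSet A → 0 < P A → ∃ B ⊆ A, MeasurableSet B ∧ 0 < P B ∧ P B < P A

/-! ### Risk measures -/

/-- The integrable real random variables. -/
def L1 (P : Measure Ω) : Set (Ω → ℝ) := {Y | Measurable Y ∧ Integrable Y P}

/-- Law-invariance of `φ` on the set `𝒳` of random variables. -/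
def LawInvariant (P : Measure Ω) (𝒳 : Set (Ω → ℝ)) (φ : (Ω → ℝ) → ℝ) : Prop :=
  ∀ Y ∈ 𝒳, ∀ Z ∈ 𝒳, P.map Y = P.map Z → φ Y = φ Z

/-- `φ` is a convex risk measure on `𝒳`: monotone, translation invariant and convex. Only the values
of `φ` on `𝒳` matter. -/
structure IsConvexRiskMeasure (P : Measure Ω) (𝒳 : Set (Ω → ℝ)) (φ : (Ω → ℝ) → ℝ) : Prop where
  mono : ∀ Y ∈ 𝒳, ∀ Z ∈ 𝒳, Y ≤ᵐ[P] Z → φ Y ≤ φ Z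
  translation : ∀ Y ∈ 𝒳, ∀ m : ℝ, φ (fun ω => Y ω + m) = φ Y + m
  convex : ∀ Y ∈ 𝒳, ∀ Z ∈ 𝒳, ∀ γ ∈ Set.Icc (0 : ℝ) 1,
    φ (fun ω => γ * Y ω + (1 - γ) * Z ω) ≤ γ * φ Y + (1 - γ) * φ Z

/-- The parameter interval `I = (0, αbar)`, where `αbar` may be `∞`. -/
def levels (αbar : ℝ≥0∞) : Set ℝ := {β | 0 < β ∧ ENNReal.ofReal β < αbar}

/-- `(ρ β)` for `β ∈ (0, αbar)` is a class of law-invariant convex risk measures on `𝒳`, decreasing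
in the parameter. Values of `ρ` at parameters outside `(0, αbar)` are irrelevant. -/
structure IsLawInvariantConvexClass (P : Measure Ω) (𝒳 : Set (Ω → ℝ)) (αbar : ℝ≥0∞)
    (ρ : ℝ → (Ω → ℝ) → ℝ) : Prop where
  lawInvariant : ∀ β ∈ levels αbar, LawInvariant P 𝒳 (ρ β)
  convexRisk : ∀ β ∈ levels αbar, IsConvexRiskMeasure P 𝒳 (ρ β)
  decreasing : ∀ Y ∈ 𝒳, AntitoneOn (fun β => ρ β Y) (levels αbar)

/-- The (left) quantile function `p ↦ inf {x | P(Y ≤ x) ≥ p}`, meaningful for `p ∈ (0, 1)`. -/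
def quantile (P : Measure Ω) (Y : Ω → ℝ) (p : ℝ) : ℝ := sInf {x : ℝ | p ≤ P.real {ω | Y ω ≤ x}}

/-- Value at Risk at level `α ∈ (0, 1)` ("small `α`" convention). -/
def VaR (P : Measure Ω) (α : ℝ) (Y : Ω → ℝ) : ℝ := sInf {x : ℝ | 1 - α ≤ P.real {ω | Y ω ≤ x}}

/-! ### The diversification quotient -/

variable {n : ℕ}

/-- The `i`-th component of a random vector. -/
def comp (X : Ω → Fin n → ℝ) (i : Fin n) : Ω → ℝ := fun ω => X ω i

/-- The sum of the components of a random vector. -/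
def total (X : Ω → Fin n → ℝ) : Ω → ℝ := fun ω => ∑ i, X ω i

/-- `α* = inf {β ∈ I | ρ_β(∑ X_i) ≤ ∑ ρ_α(X_i)}`, with `inf ∅ = αbar`. -/
def alphaStar (αbar : ℝ≥0∞) (ρ : ℝ → (Ω → ℝ) → ℝ) (α : ℝ) (X : Ω → Fin n → ℝ) : ℝ≥0∞ :=
  sInf (insert αbar (ENNReal.ofReal ''
    {β | β ∈ levels αbar ∧ ρ β (total X) ≤ ∑ i, ρ α (comp X i)}))

/-- `sup {β ∈ I | ρ_β(∑ X_i) ≥ ∑ ρ_α(X_i)}`, with `sup ∅ = 0`. -/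
def alphaTilde (αbar : ℝ≥0∞) (ρ : ℝ → (Ω → ℝ) → ℝ) (α : ℝ) (X : Ω → Fin n → ℝ) : ℝ≥0∞ :=
  sSup (ENNReal.ofReal ''
    {β | β ∈ levels αbar ∧ ∑ i, ρ α (comp X i) ≤ ρ β (total X)})

/-- The diversification quotient `α* / α` of a random vector. -/
def DQ (αbar : ℝ≥0∞) (ρ : ℝ → (Ω → ℝ) → ℝ) (α : ℝ) (X : Ω → Fin n → ℝ) : ℝ≥0∞ :=
  alphaStar αbar ρ α X / ENNReal.ofReal α

/-- A random vector on `(Ω, P)` whose law is `μ` (if there is one). -/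
def realization (P : Measure Ω) (μ : Measure (Fin n → ℝ)) : Ω → Fin n → ℝ :=
  Classical.epsilon fun Y => Measurable Y ∧ P.map Y = μ

/-- The diversification quotient of a joint law: that of any random vector with this law. For
law-invariant risk measures the chosen vector does not matter, see `DQ_eq_of_map_eq`. -/
def lawDQ (P : Measure Ω) (αbar : ℝ≥0∞) (ρ : ℝ → (Ω → ℝ) → ℝ) (α : ℝ)
    (μ : Measure (Fin n → ℝ)) : ℝ≥0∞ :=
  DQ αbar ρ α (realization P μ)

theorem DQ_eq_of_map_eq {P : Measure Ω} {𝒳 : Set (Ω → ℝ)} {αbar : ℝ≥0∞} {ρ : ℝ → (Ω → ℝ) → ℝ}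
    (hρ : ∀ β ∈ levels αbar, LawInvariant P 𝒳 (ρ β)) {α : ℝ} (hα : α ∈ levels αbar)
    {X Y : Ω → Fin n → ℝ} (hX : Measurable X) (hY : Measurable Y)
    (hXi : ∀ i, comp X i ∈ 𝒳) (hYi : ∀ i, comp Y i ∈ 𝒳) (hXs : total X ∈ 𝒳) (hYs : total Y ∈ 𝒳)
    (h : P.map X = P.map Y) : DQ αbar ρ α X = DQ αbar ρ α Y := by
  have key : ∀ f : (Fin n → ℝ) → ℝ, Measurable f →
      P.map (fun ω => f (X ω)) = P.map (fun ω => f (Y ω)) := fun f hf => by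
    have h1 := Measure.map_map (μ := P) hf hX
    have h2 := Measure.map_map (μ := P) hf hY
    rw [h] at h1
    exact h1.symm.trans h2
  have h1 : ∀ i, ρ α (comp X i) = ρ α (comp Y i) := fun i =>
    hρ α hα _ (hXi i) _ (hYi i) (key (fun x => x i) (measurable_pi_apply i))
  have h2 : ∀ β ∈ levels αbar, ρ β (total X) = ρ β (total Y) := fun β hβ =>
    hρ β hβ _ hXs _ hYs (key (fun x => ∑ i, x i) (by fun_prop))
  have h3 : {β | β ∈ levels αbar ∧ ρ β (total X) ≤ ∑ i, ρ α (comp X i)} =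
      {β | β ∈ levels αbar ∧ ρ β (total Y) ≤ ∑ i, ρ α (comp Y i)} := by
    ext β
    simp only [Set.mem_ofPred_eq, h1]
    exact and_congr_right fun hβ => by rw [h2 β hβ]
  simp only [DQ, alphaStar, h3]

/-! ### Samples

Sequences are indexed by `ℕ` starting at `0`. -/

/-- The empirical joint distribution of the first `N` sample vectors, realized at `ω`. -/
def empiricalLaw (Xs : ℕ → Ω → Fin n → ℝ) (N : ℕ) (ω : Ω) : Measure (Fin n → ℝ) :=
  (N : ℝ≥0∞)⁻¹ • ∑ k ∈ Finset.range N, Measure.dirac (Xs k ω)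

/-- The empirical estimator of the diversification quotient. -/
def empiricalDQ (P : Measure Ω) (αbar : ℝ≥0∞) (ρ : ℝ → (Ω → ℝ) → ℝ) (α : ℝ)
    (Xs : ℕ → Ω → Fin n → ℝ) (N : ℕ) (ω : Ω) : ℝ≥0∞ :=
  lawDQ P αbar ρ α (empiricalLaw Xs N ω)

/-- (Strict) stationarity: the law of the whole sequence is invariant under the shift. -/
def Stationary (P : Measure Ω) (Xs : ℕ → Ω → Fin n → ℝ) : Prop :=
  P.map (fun ω k => Xs (k + 1) ω) = P.map (fun ω k => Xs k ω)

/-- The σ-field generated by the vectors `Xs k` with `k ∈ J`. -/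
@[reducible] def sigmaField (Xs : ℕ → Ω → Fin n → ℝ) (J : Set ℕ) : MeasurableSpace Ω :=
  ⨆ k ∈ J, MeasurableSpace.comap (Xs k) inferInstance

/-- The mixing coefficient `α(m) = sup |P(A ∩ B) - P(A) P(B)|`, over all `k`, all events `A` of the
past up to time `k` and all events `B` of the future from time `k + m` on. -/
def mixingCoeff (P : Measure Ω) (Xs : ℕ → Ω → Fin n → ℝ) (m : ℕ) : ℝ :=
  sSup {r | ∃ (k : ℕ) (A B : Set Ω), MeasurableSet[sigmaField Xs (Set.Iic k)] A ∧
    MeasurableSet[sigmaField Xs (Set.Ici (k + m))] B ∧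
    r = |P.real (A ∩ B) - P.real A * P.real B|}

/-- The sequence is `α`-mixing. -/
def AlphaMixing (P : Measure Ω) (Xs : ℕ → Ω → Fin n → ℝ) : Prop :=
  Tendsto (mixingCoeff P Xs) atTop (𝓝 0)

/-- `∑ m⁻¹ (log m) (log log m)^(1+δ) α(m) < ∞` for some `δ > 0`. The sum starts at `m = 3`, the
first index with `log log m > 0`. -/
def MixingSummable (P : Measure Ω) (Xs : ℕ → Ω → Fin n → ℝ) : Prop :=
  ∃ δ : ℝ, 0 < δ ∧ Summable fun j : ℕ =>
    ((j + 3 : ℕ) : ℝ)⁻¹ * Real.log (j + 3 : ℕ) * Real.log (Real.log (j + 3 : ℕ)) ^ (1 + δ) *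
      mixingCoeff P Xs (j + 3)

end DivQuot

end

open DivQuot

/-! For a fixed outcome the estimator is the diversification quotient of a random vector on the same
space, realizing the empirical law. What remains is a deterministic semicontinuity statement,
`DQ_le_liminf_and_limsup_le`. Suppose that `ρ β` of the empirical total converges for each level
`β`, and that the sum of the marginal risks at level `α` converges. A strict inequality between the
two limits at a level `β` then survives for large `N`, and so bounds the empirical `α*` by `β`.
Levels below `α*` give the liminf bound, levels above `alphaTilde` the limsup bound; strict
monotonicity closes the gap.

Almost sure convergence at all levels at once follows from that of countably many sample means:
indicators of half-lines with rational endpoints and, in case (a), absolute values. These obey a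
strong law, because mixing makes the shift on path space ergodic (`ergodic_seqShift`) and Birkhoff's
theorem applies.

In case (b), convergence of distribution functions gives convergence of quantiles at continuity
points. In case (a), all laws are coupled through the quantile transform of one uniform variable,
which exists because the space is atomless. The coupled variables converge almost surely, hence in
mean by Scheffé's lemma, and a convex risk measure on `L¹` is automatically continuous in mean. -/

section PointwiseErgodic

/-! ### Maximal inequality and pointwise ergodic theorem -/

variable {α : Type*}

/-- The running maximum of `0` and the Birkhoff sums of `g` up to time `n`. -/
def birkhoffMax (T : α → α) (g : α → ℝ) : ℕ → α → ℝ
  | 0, _ => 0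
  | n + 1, x => max 0 (g x + birkhoffMax T g n (T x))

theorem birkhoffMax_nonneg (T : α → α) (g : α → ℝ) (n : ℕ) (x : α) : 0 ≤ birkhoffMax T g n x := by
  cases n with
  | zero => exact le_rfl
  | succ n => exact le_max_left _ _

theorem birkhoffMax_le_succ (T : α → α) (g : α → ℝ) (n : ℕ) :
    ∀ x, birkhoffMax T g n x ≤ birkhoffMax T g (n + 1) x := by
  induction n with
  | zero => exact fun x => birkhoffMax_nonneg T g 1 x
  | succ n ih => exact fun x => max_le_max le_rfl (by linarith [ih (T x)])

theorem birkhoffMax_monotone (T : α → α) (g : α → ℝ) (x : α) :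
    Monotone fun n => birkhoffMax T g n x :=
  monotone_nat_of_le_succ fun n => birkhoffMax_le_succ T g n x

theorem birkhoffSum_le_birkhoffMax (T : α → α) (g : α → ℝ) (n : ℕ) :
    ∀ x, birkhoffSum T g n x ≤ birkhoffMax T g n x := by
  induction n with
  | zero => intro x; simp [birkhoffMax]
  | succ n ih =>
    intro x
    rw [birkhoffSum_succ']
    exact (by linarith [ih (T x)] : _ ≤ g x + birkhoffMax T g n (T x)).trans (le_max_right _ _)

/-- Up to truncation at `0`, the maximum at `x` is the previous one at `T x` shifted by the finite
number `g x`. Hence the set where the maxima are unbounded is exactly `T`-invariant. -/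
theorem birkhoffMax_unbounded_iff (T : α → α) (g : α → ℝ) (x : α) :
    (∀ C : ℕ, ∃ n, (C : ℝ) < birkhoffMax T g n (T x)) ↔
      ∀ C : ℕ, ∃ n, (C : ℝ) < birkhoffMax T g n x := by
  constructor
  · intro h C
    obtain ⟨K, hK⟩ := exists_nat_gt (C - g x)
    obtain ⟨n, hn⟩ := h K
    exact ⟨n + 1, lt_of_lt_of_le (by linarith) (le_max_right _ _)⟩
  · intro h C
    obtain ⟨K, hK⟩ := exists_nat_gt (C + g x)
    obtain ⟨n, hn⟩ := h (max K 0)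
    cases n with
    | zero => simp only [birkhoffMax, max_eq_left (Nat.zero_le K)] at hn
              exact absurd hn (not_lt.2 (Nat.cast_nonneg _))
    | succ n =>
      refine ⟨n, ?_⟩
      simp only [birkhoffMax, max_eq_left (Nat.zero_le K), lt_max_iff] at hn
      rcases hn with hn | hn
      · exact absurd hn (not_lt.2 (Nat.cast_nonneg _))
      · linarith

variable [MeasurableSpace α]

theorem measurable_birkhoffMax {T : α → α} (hT : Measurable T) {g : α → ℝ} (hg : Measurable g)
    (n : ℕ) : Measurable (birkhoffMax T g n) := by
  induction n with
  | zero => exact measurable_const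
  | succ n ih => exact measurable_const.max (hg.add (ih.comp hT))

theorem integrable_birkhoffMax {ν : Measure α} {T : α → α} (hT : MeasurePreserving T ν ν)
    {g : α → ℝ} (hg : Integrable g ν) (n : ℕ) : Integrable (birkhoffMax T g n) ν := by
  induction n with
  | zero => exact integrable_zero _ _ _
  | succ n ih =>
    exact (integrable_zero _ _ _).sup (hg.add (hT.integrable_comp_of_integrable ih))

/-- By ergodicity, the set where the running maxima are unbounded is null or conull. If it were
conull, the increments `M (n + 1) - M n ∘ T` would converge to `g` almost everywhere. Their
integrals are nonnegative, as `T` preserves the measure and `M n` increases in `n`, so `g` would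
have nonnegative integral. -/
theorem Ergodic.ae_bddAbove_birkhoffSum {ν : Measure α} [IsProbabilityMeasure ν] {T : α → α}
    (hT : Ergodic T ν) {g : α → ℝ} (hg : Measurable g) (hgi : Integrable g ν)
    (hneg : ∫ x, g x ∂ν < 0) : ∀ᵐ x ∂ν, ∃ C : ℝ, ∀ n, birkhoffSum T g n x ≤ C := by
  set A : Set α := {x | ∀ C : ℕ, ∃ n, (C : ℝ) < birkhoffMax T g n x} with hA
  have hTA : T ⁻¹' A = A := by
    ext x
    exact birkhoffMax_unbounded_iff T g x
  have hAm : MeasurableSet A := by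
    have : A = ⋂ C : ℕ, ⋃ n, {x | (C : ℝ) < birkhoffMax T g n x} := by
      ext x; simp [hA]
    rw [this]
    exact MeasurableSet.iInter fun C => MeasurableSet.iUnion fun n =>
      measurableSet_lt measurable_const (measurable_birkhoffMax hT.measurable hg n)
  have hmp := hT.toMeasurePreserving
  rcases hT.toPreErgodic.ae_mem_or_ae_notMem hAm hTA with h | h
  · exfalso
    set D : ℕ → α → ℝ := fun n x => birkhoffMax T g (n + 1) x - birkhoffMax T g n (T x) with hD
    -- This form shows both the domination by `|g|` and that `D n x` equals `g x` once the maximum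
    -- at `T x` exceeds `-g x`.
    have hDeq : ∀ n x, D n x = max (-birkhoffMax T g n (T x)) (g x) := fun n x => by
      simp only [hD, birkhoffMax, ← max_sub_sub_right]
      congr 1 <;> ring
    have hI := fun n => integrable_birkhoffMax hmp hgi n
    have hDpos : ∀ n, 0 ≤ ∫ x, D n x ∂ν := fun n => by
      have h1 : ∫ x, D n x ∂ν =
          ∫ x, birkhoffMax T g (n + 1) x ∂ν - ∫ x, birkhoffMax T g n (T x) ∂ν :=
        integral_sub (hI (n + 1)) (hmp.integrable_comp_of_integrable (hI n))
      have h2 : ∫ x, birkhoffMax T g n (T x) ∂ν = ∫ x, birkhoffMax T g n x ∂ν := by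
        conv_rhs => rw [← hmp.map_eq]
        exact (integral_map hT.measurable.aemeasurable
          (measurable_birkhoffMax hT.measurable hg n).aestronglyMeasurable).symm
      rw [h1, h2, sub_nonneg]
      exact integral_mono (hI n) (hI (n + 1)) fun x => birkhoffMax_le_succ T g n x
    have hlim : Tendsto (fun n => ∫ x, D n x ∂ν) atTop (𝓝 (∫ x, g x ∂ν)) := by
      refine tendsto_integral_of_dominated_convergence (fun x => |g x|)
        (fun n => ((hI (n + 1)).sub (hmp.integrable_comp_of_integrable (hI n))).aestronglyMeasurable)
        hgi.abs (fun n => Eventually.of_forall fun x => ?_) ?_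
      · have h0 := birkhoffMax_nonneg T g n (T x)
        rw [hDeq, Real.norm_eq_abs]
        refine abs_le.2 ⟨(neg_abs_le _).trans (le_max_right _ _), max_le ?_ (le_abs_self _)⟩
        linarith [abs_nonneg (g x)]
      · filter_upwards [h] with x hx
        obtain ⟨C, hC⟩ := exists_nat_gt (-g x)
        obtain ⟨n, hn⟩ := (birkhoffMax_unbounded_iff T g x).2 hx C
        refine tendsto_const_nhds.congr' ?_
        filter_upwards [eventually_ge_atTop n] with m hm
        rw [hDeq]
        have := birkhoffMax_monotone T g (T x) hm
        exact (max_eq_right (by simp only at this; linarith)).symm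
    exact absurd (ge_of_tendsto' hlim hDpos) (not_le.2 hneg)
  · filter_upwards [h] with x hx
    simp only [hA, Set.mem_ofPred_eq, not_forall, not_exists, not_lt] at hx
    obtain ⟨C, hC⟩ := hx
    exact ⟨C, fun n => (birkhoffSum_le_birkhoffMax T g n x).trans (hC n)⟩

/-- Subtracting slightly more than the mean makes the integral negative, so the centred sums stay
below some `C` and the averages exceed the shifted mean by at most `C / n`. The margins `1 / (k +
1)` keep the exceptional set a countable union. -/
theorem Ergodic.ae_eventually_birkhoffAverage_le {ν : Measure α} [IsProbabilityMeasure ν]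
    {T : α → α} (hT : Ergodic T ν) {f : α → ℝ} (hf : Measurable f) (hfi : Integrable f ν) :
    ∀ᵐ x ∂ν, ∀ c > ∫ y, f y ∂ν, ∀ᶠ n in atTop, birkhoffAverage ℝ T f n x < c := by
  have key : ∀ k : ℕ, ∀ᵐ x ∂ν, ∃ C : ℝ, ∀ n,
      birkhoffSum T (fun y => f y - (∫ y, f y ∂ν + 1 / ((k : ℝ) + 1))) n x ≤ C := fun k => by
    refine hT.ae_bddAbove_birkhoffSum (hf.sub_const _) (hfi.sub (integrable_const _)) ?_
    rw [integral_sub hfi (integrable_const _)]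
    simp only [integral_const, probReal_univ, one_smul]
    have : (0 : ℝ) < 1 / ((k : ℝ) + 1) := by positivity
    linarith
  filter_upwards [ae_all_iff.2 key] with x hx c hc
  obtain ⟨k, hk⟩ := exists_nat_one_div_lt (sub_pos.2 hc)
  obtain ⟨C, hC⟩ := hx k
  set a := ∫ y, f y ∂ν + 1 / ((k : ℝ) + 1) with ha
  have hac : 0 < c - a := by linarith
  have hlim : Tendsto (fun n : ℕ => C / (n : ℝ)) atTop (𝓝 0) :=
    tendsto_const_div_atTop_nhds_zero_nat C
  filter_upwards [hlim.eventually (gt_mem_nhds hac), eventually_gt_atTop 0] with n hn hn0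
  have hn0' : (0 : ℝ) < n := by exact_mod_cast hn0
  have h1 : birkhoffSum T f n x - n * a ≤ C := by
    have := hC n
    simp only [birkhoffSum, Finset.sum_sub_distrib, Finset.sum_const, Finset.card_range,
      nsmul_eq_mul] at this
    exact this
  rw [birkhoffAverage, smul_eq_mul]
  rw [div_lt_iff₀ hn0'] at hn
  rw [inv_mul_lt_iff₀ hn0']
  linarith

/-- **Pointwise ergodic theorem** for ergodic transformations of a probability space. -/
theorem Ergodic.ae_tendsto_birkhoffAverage {ν : Measure α} [IsProbabilityMeasure ν]
    {T : α → α} (hT : Ergodic T ν) {f : α → ℝ} (hf : Measurable f) (hfi : Integrable f ν) :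
    ∀ᵐ x ∂ν, Tendsto (fun n => birkhoffAverage ℝ T f n x) atTop (𝓝 (∫ y, f y ∂ν)) := by
  filter_upwards [hT.ae_eventually_birkhoffAverage_le hf hfi,
    hT.ae_eventually_birkhoffAverage_le hf.neg hfi.neg] with x h1 h2
  refine tendsto_order.2 ⟨fun c hc => ?_, fun c hc => h1 c hc⟩
  filter_upwards [h2 (-c) (by simpa [integral_neg] using hc)] with n hn
  simp only [birkhoffAverage, birkhoffSum, Pi.neg_apply, Finset.sum_neg_distrib, smul_neg] at hn ⊢
  linarith

end PointwiseErgodic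

/-! ### Ergodicity and the strong law for mixing sequences -/

section Mixing

theorem measurable_sigmaField {Ω : Type*} {n : ℕ} (Xs : ℕ → Ω → Fin n → ℝ) {J : Set ℕ} {k : ℕ} (hk : k ∈ J) :
    Measurable[sigmaField Xs J] (Xs k) :=
  (comap_measurable (Xs k)).mono
    (le_iSup₂ (f := fun k (_ : k ∈ J) => MeasurableSpace.comap (Xs k) inferInstance) k hk) le_rfl

theorem measurableSet_preimage_path {Ω E : Type*} [MeasurableSpace E] {m : MeasurableSpace Ω}
    {f : ℕ → Ω → E} (hf : ∀ k, Measurable[m] (f k)) {B : Set (ℕ → E)} (hB : MeasurableSet B) :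
    MeasurableSet[m] ((fun ω k => f k ω) ⁻¹' B) :=
  measurable_pi_lambda _ hf hB

variable {Ω : Type*} [MeasurableSpace Ω] {n : ℕ}

theorem sigmaField_le {Xs : ℕ → Ω → Fin n → ℝ} (hXs : ∀ k, Measurable (Xs k)) (J : Set ℕ) :
    sigmaField Xs J ≤ ‹MeasurableSpace Ω› :=
  iSup₂_le fun k _ => (hXs k).comap_le

theorem abs_sub_le_mixingCoeff (P : Measure Ω) [IsProbabilityMeasure P] (Xs : ℕ → Ω → Fin n → ℝ)
    {k m : ℕ} {A B : Set Ω} (hA : MeasurableSet[sigmaField Xs (Set.Iic k)] A)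
    (hB : MeasurableSet[sigmaField Xs (Set.Ici (k + m))] B) :
    |P.real (A ∩ B) - P.real A * P.real B| ≤ mixingCoeff P Xs m := by
  refine le_csSup ⟨1, ?_⟩ ⟨k, A, B, hA, hB, rfl⟩
  rintro r ⟨k, A, B, -, -, rfl⟩
  have h1 : P.real A * P.real B ≤ 1 :=
    mul_le_one₀ measureReal_le_one measureReal_nonneg measureReal_le_one
  have h2 : 0 ≤ P.real A * P.real B := mul_nonneg measureReal_nonneg measureReal_nonneg
  have h3 : P.real (A ∩ B) ≤ 1 := measureReal_le_one
  have h4 : 0 ≤ P.real (A ∩ B) := measureReal_nonneg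
  exact abs_le.2 ⟨by linarith, by linarith⟩

/-- The shift of sequences. -/
def seqShift (E : Type*) (x : ℕ → E) : ℕ → E := fun k => x (k + 1)

theorem seqShift_iterate {E : Type*} (m : ℕ) (x : ℕ → E) (k : ℕ) :
    (seqShift E)^[m] x k = x (k + m) := by
  induction m generalizing k with
  | zero => rfl
  | succ m ih =>
    rw [Function.iterate_succ_apply']
    exact (ih (k + 1)).trans (by rw [add_right_comm, add_assoc])

theorem measurable_seqShift (E : Type*) [MeasurableSpace E] : Measurable (seqShift E) :=
  measurable_pi_lambda _ fun k => measurable_pi_apply (k + 1)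

/-- A stationary `α`-mixing sequence generates an ergodic shift on the path space. -/
theorem ergodic_seqShift {P : Measure Ω} [IsProbabilityMeasure P] {Xs : ℕ → Ω → Fin n → ℝ}
    (hXs : ∀ k, Measurable (Xs k)) (hstat : Stationary P Xs) (hmix : AlphaMixing P Xs) :
    Ergodic (seqShift (Fin n → ℝ)) (P.map fun ω k => Xs k ω) := by
  have hseq : Measurable fun ω k => Xs k ω := measurable_pi_lambda _ hXs
  have hT := measurable_seqShift (Fin n → ℝ)
  have : IsProbabilityMeasure (P.map fun ω k => Xs k ω) :=
    Measure.isProbabilityMeasure_map hseq.aemeasurable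
  refine ⟨⟨hT, (Measure.map_map hT hseq).trans hstat⟩, ⟨fun B hB hTB => ?_⟩⟩
  set A : Set Ω := (fun ω k => Xs k ω) ⁻¹' B with hA
  have hAm : MeasurableSet A := hseq hB
  -- A shift-invariant event can be read off from any tail of the sequence.
  have htail : ∀ m, MeasurableSet[sigmaField Xs (Set.Ici m)] A := fun m => by
    have h1 : (seqShift (Fin n → ℝ))^[m] ⁻¹' B = B :=
      Function.IsFixedPt.preimage_iterate hTB m
    have h2 : A = (fun ω k => Xs (k + m) ω) ⁻¹' B := by
      rw [hA]
      conv_lhs => rw [← h1]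
      ext ω
      simp only [Set.mem_preimage]
      rw [show (seqShift (Fin n → ℝ))^[m] (fun k => Xs k ω) = fun k => Xs (k + m) ω from
        funext fun k => seqShift_iterate m _ k]
    rw [h2]
    exact measurableSet_preimage_path
      (fun k => measurable_sigmaField Xs (Set.mem_Ici.2 (Nat.le_add_left m k))) hB
  -- As `A` lies in the future beyond every gap `m`, letting `m` tend to infinity makes it
  -- independent of each past. It is then independent of the σ-field the pasts generate, which
  -- contains `A`, so `A` is independent of itself.
  have hprod : ∀ k, ∀ D, MeasurableSet[sigmaField Xs (Set.Iic k)] D →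
      P.real (D ∩ A) = P.real D * P.real A := fun k D hD => by
    have h1 : |P.real (D ∩ A) - P.real D * P.real A| ≤ 0 :=
      ge_of_tendsto' hmix fun m => abs_sub_le_mixingCoeff P Xs hD (htail (k + m))
    exact sub_eq_zero.1 (abs_nonpos_iff.1 h1)
  have hind : ∀ k, Indep (sigmaField Xs (Set.Iic k)) (MeasurableSpace.generateFrom {A}) P :=
    fun k => by
      refine IndepSets.indep (sigmaField_le hXs _)
        (MeasurableSpace.generateFrom_le fun t ht => by rw [ht]; exact hAm)
        (@MeasurableSpace.isPiSystem_measurableSet _ (sigmaField Xs (Set.Iic k))) (IsPiSystem.singleton A)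
        (@MeasurableSpace.generateFrom_measurableSet _ (sigmaField Xs (Set.Iic k))).symm rfl ?_
      rw [IndepSets_iff]
      rintro D C hD rfl
      have := hprod k D hD
      rw [← ENNReal.toReal_eq_toReal_iff' (by finiteness) (by finiteness), ENNReal.toReal_mul]
      exact this
  have hmono : Monotone fun k => sigmaField Xs (Set.Iic k) := fun k l hkl =>
    biSup_mono fun j hj => le_trans hj hkl
  have hsup := indep_iSup_of_monotone hind (fun k => sigmaField_le hXs _)
    (MeasurableSpace.generateFrom_le fun t ht => by rw [ht]; exact hAm) hmono
  have hAsup : MeasurableSet[⨆ k, sigmaField Xs (Set.Iic k)] A := by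
    refine measurableSet_preimage_path (fun k => ?_) hB
    exact (measurable_sigmaField Xs (Set.mem_Iic.2 (le_refl k))).mono
      (le_iSup (fun k => sigmaField Xs (Set.Iic k)) k) le_rfl
  have h01 : P A = 0 ∨ P A = 1 := by
    exact measure_eq_zero_or_one_of_indepSet_self <|
      hsup.indepSet_of_measurableSet hAsup (MeasurableSpace.measurableSet_generateFrom rfl)
  rw [eventuallyConst_set']
  rcases h01 with h | h
  · left
    rw [ae_eq_empty, Measure.map_apply hseq hB]
    exact h
  · right
    rw [ae_eq_univ, prob_compl_eq_zero_iff hB, Measure.map_apply hseq hB]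
    exact h

/-- Strong law of large numbers for stationary `α`-mixing sequences. -/
theorem ae_tendsto_sampleMean {P : Measure Ω} [IsProbabilityMeasure P] {Xs : ℕ → Ω → Fin n → ℝ}
    (hXs : ∀ k, Measurable (Xs k)) (hstat : Stationary P Xs) (hmix : AlphaMixing P Xs)
    {g : (Fin n → ℝ) → ℝ} (hg : Measurable g) (hgi : Integrable g (P.map (Xs 0))) :
    ∀ᵐ ω ∂P, Tendsto (fun N : ℕ => (N : ℝ)⁻¹ * ∑ k ∈ Finset.range N, g (Xs k ω)) atTop
      (𝓝 (∫ x, g x ∂(P.map (Xs 0)))) := by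
  have hseq : Measurable fun ω k => Xs k ω := measurable_pi_lambda _ hXs
  have : IsProbabilityMeasure (P.map fun ω k => Xs k ω) :=
    Measure.isProbabilityMeasure_map hseq.aemeasurable
  have h0 : Measurable fun x : ℕ → Fin n → ℝ => x 0 := measurable_pi_apply 0
  have hmap : (P.map fun ω k => Xs k ω).map (fun x => x 0) = P.map (Xs 0) :=
    Measure.map_map h0 hseq
  rw [← hmap] at hgi ⊢
  -- Sample means are Birkhoff averages of an observable of coordinate `0` on path space.
  have key := (ergodic_seqShift hXs hstat hmix).ae_tendsto_birkhoffAverage (hg.comp h0)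
    ((integrable_map_measure hg.aestronglyMeasurable h0.aemeasurable).1 hgi)
  rw [integral_map h0.aemeasurable hg.aestronglyMeasurable]
  filter_upwards [ae_of_ae_map hseq.aemeasurable key] with ω hω
  refine hω.congr fun N => ?_
  simp only [birkhoffAverage, birkhoffSum, smul_eq_mul, Function.comp_apply, seqShift_iterate,
    zero_add]

end Mixing

/-! ### Uniform variables on atomless spaces -/

section Atomless

variable {Ω : Type*} [MeasurableSpace Ω] {P : Measure Ω} [IsProbabilityMeasure P]

theorem DivQuot.Atomless.exists_subset_le_half (hP : Atomless P) {A : Set Ω} (hA : MeasurableSet A)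
    (h0 : 0 < P.real A) :
    ∃ B ⊆ A, MeasurableSet B ∧ 0 < P.real B ∧ P.real B ≤ P.real A / 2 := by
  obtain ⟨C, hCA, hC, hC0, hCl⟩ := hP A hA (ENNReal.toReal_pos_iff.1 h0).1
  have h1 : 0 < P.real C := ENNReal.toReal_pos hC0.ne' (by finiteness)
  have h2 : P.real C < P.real A := (ENNReal.toReal_lt_toReal (by finiteness) (by finiteness)).2 hCl
  have h3 : P.real (A \ C) = P.real A - P.real C := measureReal_sdiff hCA hC
  rcases le_total (P.real C) (P.real A / 2) with h | h
  · exact ⟨C, hCA, hC, h1, h⟩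
  · exact ⟨A \ C, Set.sdiff_subset, hA.diff hC, by linarith, by linarith⟩

theorem DivQuot.Atomless.exists_subset_lt (hP : Atomless P) {A : Set Ω} (hA : MeasurableSet A)
    (h0 : 0 < P.real A) {ε : ℝ} (hε : 0 < ε) :
    ∃ B ⊆ A, MeasurableSet B ∧ 0 < P.real B ∧ P.real B < ε := by
  have key : ∀ k : ℕ, ∃ B ⊆ A, MeasurableSet B ∧ 0 < P.real B ∧ P.real B ≤ (1 / 2) ^ k := by
    intro k
    induction k with
    | zero => exact ⟨A, subset_rfl, hA, h0, by simp⟩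
    | succ k ih =>
      obtain ⟨B, hBA, hB, hB0, hBl⟩ := ih
      obtain ⟨C, hCB, hC, hC0, hCl⟩ := hP.exists_subset_le_half hB hB0
      exact ⟨C, hCB.trans hBA, hC, hC0, by rw [pow_succ]; linarith⟩
  obtain ⟨k, hk⟩ := exists_pow_lt_of_lt_one hε (by norm_num : (1 / 2 : ℝ) < 1)
  obtain ⟨B, h1, h2, h3, h4⟩ := key k
  exact ⟨B, h1, h2, h3, h4.trans_lt hk⟩

/-- **Sierpiński's theorem**: an atomless probability measure takes all intermediate values. -/
theorem DivQuot.Atomless.exists_measure_between (hP : Atomless P) {A B : Set Ω} (hA : MeasurableSet A)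
    (hB : MeasurableSet B) (hAB : A ⊆ B) {t : ℝ} (ht : t ∈ Set.Icc (P.real A) (P.real B)) :
    ∃ M, MeasurableSet M ∧ A ⊆ M ∧ M ⊆ B ∧ P.real M = t := by
  let S : Set (Set Ω) := {D | MeasurableSet D ∧ A ⊆ D ∧ D ⊆ B ∧ P.real D ≤ t}
  -- Greedy extension: `C'` covers at least half the distance from the measure of `C` to the
  -- supremum over admissible extensions.
  have hstep : ∀ C : S, ∃ C' : S, C.1 ⊆ C'.1 ∧
      ∀ D : S, C.1 ⊆ D.1 → P.real D.1 + P.real C.1 ≤ 2 * P.real C'.1 := fun C => by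
    let R : Set ℝ := {r | ∃ D : S, C.1 ⊆ D.1 ∧ r = P.real D.1}
    have hRb : BddAbove R := ⟨t, by rintro r ⟨D, -, rfl⟩; exact D.2.2.2.2⟩
    have hRC : P.real C.1 ∈ R := ⟨C, subset_rfl, rfl⟩
    rcases (le_csSup hRb hRC).eq_or_lt with h | h
    · refine ⟨C, subset_rfl, fun D hD => ?_⟩
      have := le_csSup hRb ⟨D, hD, rfl⟩
      linarith
    · obtain ⟨r, ⟨C', hCC', rfl⟩, hr⟩ := exists_lt_of_lt_csSup ⟨_, hRC⟩
        (show (P.real C.1 + sSup R) / 2 < sSup R by linarith)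
      refine ⟨C', hCC', fun D hD => ?_⟩
      have := le_csSup hRb ⟨D, hD, rfl⟩
      linarith
  choose next hsub hnext using hstep
  let F : ℕ → S := fun k => next^[k] ⟨A, hA, subset_rfl, hAB, ht.1⟩
  have hF : ∀ k, F (k + 1) = next (F k) := fun k => Function.iterate_succ_apply' _ _ _
  have hmono : Monotone fun k => (F k).1 := monotone_nat_of_le_succ fun k => by
    rw [hF]; exact hsub _
  have hlim : Tendsto (fun k => P.real (F k).1) atTop (𝓝 (P.real (⋃ k, (F k).1))) :=
    (ENNReal.tendsto_toReal (by finiteness)).comp (tendsto_measure_iUnion_atTop hmono)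
  set M := ⋃ k, (F k).1 with hM
  have hMm : MeasurableSet M := MeasurableSet.iUnion fun k => (F k).2.1
  have hAM : A ⊆ M := (F 0).2.2.1.trans (Set.subset_iUnion (fun k => (F k).1) 0)
  have hMB : M ⊆ B := Set.iUnion_subset fun k => (F k).2.2.2.1
  have hMt : P.real M ≤ t := le_of_tendsto' hlim fun k => (F k).2.2.2.2
  refine ⟨M, hMm, hAM, hMB, hMt.antisymm (not_lt.1 fun hlt => ?_)⟩
  have hd : P.real (B \ M) = P.real B - P.real M := measureReal_sdiff hMB hMm
  -- If the greedy union fell short of `t`, a small piece `D` could still be added. Then `M ∪ D`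
  -- competes at every stage, and the limit of the greedy inequality gives `P.real (M ∪ D) ≤ P.real
  -- M`, a contradiction.
  obtain ⟨D, hDB, hD, hD0, hDl⟩ := hP.exists_subset_lt (hB.diff hMm)
    (by linarith [ht.2]) (sub_pos.2 hlt)
  have hu : P.real (M ∪ D) = P.real M + P.real D :=
    measureReal_union (Set.disjoint_left.2 fun x hx hxD => (hDB hxD).2 hx) hD
  let E : S := ⟨M ∪ D, hMm.union hD, hAM.trans Set.subset_union_left,
    Set.union_subset hMB (hDB.trans Set.sdiff_subset), by rw [hu]; linarith⟩
  have h1 : ∀ k, P.real (M ∪ D) + P.real (F k).1 ≤ 2 * P.real (F (k + 1)).1 := fun k => by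
    rw [hF]
    exact hnext (F k) E ((Set.subset_iUnion (fun k => (F k).1) k).trans Set.subset_union_left)
  have h2 := le_of_tendsto_of_tendsto' (hlim.const_add (P.real (M ∪ D)))
    (((tendsto_add_atTop_iff_nat 1).2 hlim).const_mul 2) h1
  linarith

/-- Dyadic refinement of a chain of sets, inserting midpoints at the odd indices. -/
def dyadicChain {Ω : Type*} (mid : Set Ω → Set Ω → Set Ω) : ℕ → ℕ → Set Ω
  | 0, j => if j = 0 then ∅ else Set.univ
  | k + 1, j =>
    if Even j then dyadicChain mid k (j / 2)
    else mid (dyadicChain mid k (j / 2)) (dyadicChain mid k (j / 2 + 1))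

theorem dyadicChain_two_mul {Ω : Type*} (mid : Set Ω → Set Ω → Set Ω) (k j : ℕ) :
    dyadicChain mid (k + 1) (2 * j) = dyadicChain mid k j := by
  simp [dyadicChain]

theorem dyadicChain_two_mul_add_one {Ω : Type*} (mid : Set Ω → Set Ω → Set Ω) (k j : ℕ) :
    dyadicChain mid (k + 1) (2 * j + 1) =
      mid (dyadicChain mid k j) (dyadicChain mid k (j + 1)) := by
  have h : (2 * j + 1) / 2 = j := by omega
  simp [dyadicChain, h]

theorem dyadicChain_pow_mul {Ω : Type*} (mid : Set Ω → Set Ω → Set Ω) (k m j : ℕ) :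
    dyadicChain mid (k + m) (2 ^ m * j) = dyadicChain mid k j := by
  induction m with
  | zero => simp
  | succ m ih => rw [← add_assoc, pow_succ', mul_assoc, dyadicChain_two_mul, ih]

theorem DivQuot.Atomless.exists_dyadicChain (hP : Atomless P) : ∃ C : ℕ → ℕ → Set Ω,
    (∀ k j, MeasurableSet (C k j)) ∧ (∀ k, Monotone (C k)) ∧
    (∀ k j, P.real (C k j) = min ((j : ℝ) / 2 ^ k) 1) ∧ C 0 1 = Set.univ ∧
    ∀ k m j, C (k + m) (2 ^ m * j) = C k j := by
  -- The hypotheses sit under the existential so that `choose` yields a total midpoint function, as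
  -- the recursion of `dyadicChain` requires.
  have hmid : ∀ A B : Set Ω, ∃ M, MeasurableSet A → MeasurableSet B → A ⊆ B →
      MeasurableSet M ∧ A ⊆ M ∧ M ⊆ B ∧ P.real M = (P.real A + P.real B) / 2 := fun A B => by
    by_cases h : MeasurableSet A ∧ MeasurableSet B ∧ A ⊆ B
    · obtain ⟨hA, hB, hAB⟩ := h
      have := measureReal_mono (μ := P) hAB
      obtain ⟨M, hM⟩ := hP.exists_measure_between hA hB hAB (t := (P.real A + P.real B) / 2)
        ⟨by linarith, by linarith⟩
      exact ⟨M, fun _ _ _ => hM⟩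
    · exact ⟨∅, fun hA hB hAB => absurd ⟨hA, hB, hAB⟩ h⟩
  choose mid hmid using hmid
  have key : ∀ k, (∀ j, MeasurableSet (dyadicChain mid k j)) ∧ Monotone (dyadicChain mid k) ∧
      ∀ j : ℕ, P.real (dyadicChain mid k j) = min ((j : ℝ) / 2 ^ k) 1 := by
    intro k
    induction k with
    | zero =>
      refine ⟨fun j => ?_, monotone_nat_of_le_succ fun j => by simp [dyadicChain], fun j => ?_⟩
      · by_cases hj : j = 0 <;> simp [dyadicChain, hj]
      · by_cases hj : j = 0
        · simp [dyadicChain, hj]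
        · have : (1 : ℝ) ≤ j := by exact_mod_cast Nat.one_le_iff_ne_zero.2 hj
          simp [dyadicChain, hj, this]
    | succ k ih =>
      obtain ⟨h1, h2, h3⟩ := ih
      have hm := fun j => hmid _ _ (h1 j) (h1 (j + 1)) (h2 (Nat.le_succ j))
      refine ⟨fun j => ?_, monotone_nat_of_le_succ fun j => ?_, fun j => ?_⟩
      · obtain ⟨i, rfl | rfl⟩ := Nat.even_or_odd' j
        · rw [dyadicChain_two_mul]; exact h1 i
        · rw [dyadicChain_two_mul_add_one]; exact (hm i).1
      · obtain ⟨i, rfl | rfl⟩ := Nat.even_or_odd' j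
        · rw [dyadicChain_two_mul, dyadicChain_two_mul_add_one]; exact (hm i).2.1
        · rw [dyadicChain_two_mul_add_one, show 2 * i + 1 + 1 = 2 * (i + 1) by ring,
            dyadicChain_two_mul]
          exact (hm i).2.2.1
      · have hk : (0 : ℝ) < 2 ^ k := by positivity
        obtain ⟨i, rfl | rfl⟩ := Nat.even_or_odd' j
        · rw [dyadicChain_two_mul, h3]
          congr 1
          push_cast
          field_simp
          ring
        · rw [dyadicChain_two_mul_add_one, (hm i).2.2.2, h3, h3]
          rcases Nat.lt_or_ge i (2 ^ k) with hi | hi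
          · have hi' : ((i + 1 : ℕ) : ℝ) ≤ 2 ^ k := by exact_mod_cast hi
            push_cast at hi' ⊢
            rw [min_eq_left ((div_le_one hk).2 (by linarith)), min_eq_left ((div_le_one hk).2 hi'),
              min_eq_left ((div_le_one (by positivity)).2 (by rw [pow_succ]; linarith))]
            field_simp
            ring
          · have hi' : (2 : ℝ) ^ k ≤ i := by exact_mod_cast hi
            push_cast
            rw [min_eq_right ((one_le_div hk).2 hi'), min_eq_right ((one_le_div hk).2 (by linarith)),
              min_eq_right ((one_le_div (by positivity)).2 (by rw [pow_succ]; linarith))]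
            norm_num
  exact ⟨dyadicChain mid, fun k => (key k).1, fun k => (key k).2.1, fun k => (key k).2.2,
    by simp [dyadicChain], dyadicChain_pow_mul mid⟩

/-- `U` is uniformly distributed on the open unit interval, and takes values there. -/
structure IsUniform (P : Measure Ω) (U : Ω → ℝ) : Prop where
  measurable : Measurable U
  mem : ∀ ω, U ω ∈ Set.Ioo (0 : ℝ) 1
  cdf : ∀ x ∈ Set.Icc (0 : ℝ) 1, P.real {ω | U ω ≤ x} = x

/-- The dyadic chain provides the sublevel sets: `U ω` is the infimum of the dyadic numbers whose
set contains `ω`. Rounding `x * 2 ^ k` up or down traps the distribution function at `x` up to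
`2⁻ᵏ`. -/
theorem DivQuot.Atomless.exists_measurable_cdf (hP : Atomless P) :
    ∃ U : Ω → ℝ, Measurable U ∧ ∀ x ∈ Set.Icc (0 : ℝ) 1, P.real {ω | U ω ≤ x} = x := by
  obtain ⟨C, hCm, hCmono, hCP, hC01, hCpow⟩ := hP.exists_dyadicChain
  have hsub : ∀ k j k' j' : ℕ, (j : ℝ) / 2 ^ k ≤ j' / 2 ^ k' → C k j ⊆ C k' j' := by
    intro k j k' j' h
    -- Both sets are moved to the common refinement level `k + k'`, where the chain is monotone in
    -- its index.
    rw [← hCpow k k' j, ← hCpow k' k j', add_comm k']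
    refine hCmono _ ?_
    rw [div_le_div_iff₀ (by positivity) (by positivity)] at h
    have h' : j * 2 ^ k' ≤ j' * 2 ^ k := by exact_mod_cast h
    linarith
  let V : Ω → Set ℝ := fun ω => {x | ∃ k j : ℕ, ω ∈ C k j ∧ x = (j : ℝ) / 2 ^ k}
  have hVb : ∀ ω, BddBelow (V ω) := fun ω => ⟨0, by rintro x ⟨k, j, -, rfl⟩; positivity⟩
  have hVn : ∀ ω, (V ω).Nonempty := fun ω => ⟨_, 0, 1, by rw [hC01]; trivial, rfl⟩
  have hlt : ∀ x, {ω | sInf (V ω) < x} =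
      ⋃ k : ℕ, ⋃ j : ℕ, ⋃ _ : (j : ℝ) / 2 ^ k < x, C k j := fun x => by
    ext ω
    simp only [Set.mem_ofPred_eq, Set.mem_iUnion, csInf_lt_iff (hVb ω) (hVn ω)]
    constructor
    · rintro ⟨_, ⟨k, j, hω, rfl⟩, hx⟩
      exact ⟨k, j, hx, hω⟩
    · rintro ⟨k, j, hx, hω⟩
      exact ⟨_, ⟨k, j, hω, rfl⟩, hx⟩
  have hUm : Measurable fun ω => sInf (V ω) := measurable_of_Iio fun x => by
    have := hlt x
    change MeasurableSet {ω | sInf (V ω) < x}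
    rw [this]
    exact MeasurableSet.iUnion fun k => MeasurableSet.iUnion fun j =>
      MeasurableSet.iUnion fun _ => hCm k j
  have hpow : Tendsto (fun k : ℕ => (1 / 2 : ℝ) ^ k) atTop (𝓝 0) :=
    tendsto_pow_atTop_nhds_zero_of_lt_one (by norm_num) (by norm_num)
  have hupper : ∀ x, 0 ≤ x → P.real {ω | sInf (V ω) < x} ≤ x := fun x hx => by
    refine ge_of_tendsto' (f := fun k : ℕ => x + (1 / 2 : ℝ) ^ k) (x := atTop)
      (by simpa using hpow.const_add x) fun k => ?_
    have hk : (0 : ℝ) < 2 ^ k := by positivity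
    have h1 : {ω | sInf (V ω) < x} ⊆ C k ⌈x * 2 ^ k⌉₊ := by
      rw [hlt]
      refine Set.iUnion_subset fun k' => Set.iUnion_subset fun j => Set.iUnion_subset fun hj => ?_
      refine hsub _ _ _ _ (hj.le.trans ?_)
      rw [le_div_iff₀ hk]
      exact Nat.le_ceil _
    refine (measureReal_mono h1).trans ?_
    rw [hCP]
    refine (min_le_left _ _).trans ?_
    rw [div_le_iff₀ hk, add_mul, ← mul_pow (1 / 2 : ℝ) 2 k]
    have := Nat.ceil_lt_add_one (a := x * 2 ^ k) (by positivity)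
    norm_num
    exact this.le
  refine ⟨_, hUm, fun x hx => le_antisymm ?_ ?_⟩
  · refine le_of_forall_pos_le_add fun ε hε => (measureReal_mono ?_).trans
      (hupper (x + ε) (by linarith [hx.1]))
    intro ω hω
    have hω' : sInf (V ω) ≤ x := hω
    change sInf (V ω) < x + ε
    linarith
  · refine le_of_tendsto' (f := fun k : ℕ => x - (1 / 2 : ℝ) ^ k) (x := atTop)
      (by simpa using hpow.const_sub x) fun k => ?_
    have hk : (0 : ℝ) < 2 ^ k := by positivity
    have hfl : (⌊x * 2 ^ k⌋₊ : ℝ) ≤ x * 2 ^ k := Nat.floor_le (mul_nonneg hx.1 hk.le)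
    have h1 : C k ⌊x * 2 ^ k⌋₊ ⊆ {ω | sInf (V ω) ≤ x} := fun ω hω =>
      (csInf_le (hVb ω) ⟨k, _, hω, rfl⟩).trans ((div_le_iff₀ hk).2 hfl)
    refine le_trans ?_ (measureReal_mono h1)
    rw [hCP]
    refine le_min ?_ (by linarith [hx.2, show (0 : ℝ) < (1 / 2) ^ k by positivity])
    rw [le_div_iff₀ hk, sub_mul, ← mul_pow (1 / 2 : ℝ) 2 k]
    have := Nat.lt_floor_add_one (x * 2 ^ k)
    norm_num
    exact this.le

theorem DivQuot.Atomless.exists_isUniform (hP : Atomless P) : ∃ U : Ω → ℝ, IsUniform P U := by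
  classical
  obtain ⟨U, hU, hcdf⟩ := hP.exists_measurable_cdf
  have h0 : ∀ᵐ ω ∂P, 0 < U ω := by
    have : P.real {ω | U ω ≤ 0} = 0 := hcdf 0 ⟨le_rfl, zero_le_one⟩
    rw [measureReal_eq_zero_iff] at this
    simpa only [ae_iff, not_lt] using this
  have h1 : ∀ᵐ ω ∂P, U ω < 1 := by
    have h : P.real {ω | U ω < 1} = 1 := by
      refine le_antisymm measureReal_le_one (le_of_forall_pos_le_add fun ε hε => ?_)
      rcases le_or_gt 1 ε with h | h
      · linarith [measureReal_nonneg (μ := P) (s := {ω | U ω < 1})]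
      · have h2 := hcdf (1 - ε) ⟨by linarith, by linarith⟩
        have h3 : P.real {ω | U ω ≤ 1 - ε} ≤ P.real {ω | U ω < 1} :=
          measureReal_mono fun ω (hω : U ω ≤ 1 - ε) => show U ω < 1 by linarith
        linarith
    rw [ae_iff]
    exact (prob_compl_eq_zero_iff (measurableSet_lt hU measurable_const)).2
      ((ENNReal.toReal_eq_one_iff _).1 h)
  have hae : (fun ω => if U ω ∈ Set.Ioo (0 : ℝ) 1 then U ω else 1 / 2) =ᵐ[P] U := by
    filter_upwards [h0, h1] with ω h0 h1
    simp [h0, h1]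
  -- Redefinition on a null set keeps `U` inside the open interval, where quantiles are meaningful.
  refine ⟨fun ω => if U ω ∈ Set.Ioo (0 : ℝ) 1 then U ω else 1 / 2,
    Measurable.ite (hU measurableSet_Ioo) hU measurable_const, fun ω => ?_, fun x hx => ?_⟩
  · split_ifs with h
    · exact h
    · norm_num
  · refine (measureReal_congr ?_).trans (hcdf x hx)
    filter_upwards [hae] with ω hω
    exact congrArg (· ≤ x) hω

/-- A probability law on a standard Borel space is an image of Lebesgue measure on the unit
interval. Thus every empirical law is realized on `Ω` itself. -/
theorem IsUniform.exists_map_eq {E : Type*} [MeasurableSpace E] [StandardBorelSpace E] {U : Ω → ℝ}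
    (hU : IsUniform P U) (μ : Measure E) [IsProbabilityMeasure μ] :
    ∃ Y : Ω → E, Measurable Y ∧ P.map Y = μ := by
  have : Nonempty E := nonempty_of_isProbabilityMeasure μ
  obtain ⟨f, hf, hfμ⟩ := μ.exists_measurable_map_eq
  let V : Ω → unitInterval := fun ω => ⟨U ω, (hU.mem ω).1.le, (hU.mem ω).2.le⟩
  have hV : Measurable V := hU.measurable.subtype_mk
  have hmap : P.map V = volume := by
    have : IsProbabilityMeasure (P.map V) := Measure.isProbabilityMeasure_map hV.aemeasurable
    refine Measure.ext_of_Iic _ _ fun x => ?_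
    rw [Measure.map_apply hV measurableSet_Iic, unitInterval.volume_Iic]
    have h1 : V ⁻¹' Set.Iic x = {ω | U ω ≤ x} := rfl
    rw [h1, ← hU.cdf x x.2, ofReal_measureReal]
    rw [hU.cdf x x.2]
  exact ⟨f ∘ V, hf.comp hV, by rw [← Measure.map_map hf hV, hmap, hfμ]⟩

end Atomless

/-! ### Quantile functions and their convergence -/

section Quantile

variable {Ω : Type*} [MeasurableSpace Ω] {P : Measure Ω} [IsProbabilityMeasure P]

theorem cdf_map_eq {Y : Ω → ℝ} (hY : Measurable Y) (x : ℝ) :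
    cdf (P.map Y) x = P.real {ω | Y ω ≤ x} := by
  have : IsProbabilityMeasure (P.map Y) := Measure.isProbabilityMeasure_map hY.aemeasurable
  rw [cdf_eq_real, map_measureReal_apply hY measurableSet_Iic]
  rfl

theorem monotone_measureReal_le (Y : Ω → ℝ) : Monotone fun x => P.real {ω | Y ω ≤ x} :=
  fun _ _ hab => measureReal_mono fun _ (hω : _ ≤ _) => hω.trans hab

theorem quantileSet_nonempty {Y : Ω → ℝ} (hY : Measurable Y) {p : ℝ} (hp : p ∈ Set.Ioo (0 : ℝ) 1) :
    {x : ℝ | p ≤ P.real {ω | Y ω ≤ x}}.Nonempty := by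
  obtain ⟨x, hx⟩ := ((tendsto_cdf_atTop (P.map Y)).eventually (lt_mem_nhds hp.2)).exists
  rw [cdf_map_eq hY] at hx
  exact ⟨x, hx.le⟩

theorem quantileSet_bddBelow {Y : Ω → ℝ} (hY : Measurable Y) {p : ℝ} (hp : p ∈ Set.Ioo (0 : ℝ) 1) :
    BddBelow {x : ℝ | p ≤ P.real {ω | Y ω ≤ x}} := by
  obtain ⟨x, hx⟩ := ((tendsto_cdf_atBot (P.map Y)).eventually (gt_mem_nhds hp.1)).exists
  rw [cdf_map_eq hY] at hx
  refine ⟨x, fun y hy => le_of_not_gt fun hyx => ?_⟩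
  exact absurd (le_trans hy (monotone_measureReal_le Y hyx.le)) (not_le.2 hx)

/-- Galois connection between the quantile function and the distribution function. -/
theorem quantile_le_iff {Y : Ω → ℝ} (hY : Measurable Y) {p : ℝ} (hp : p ∈ Set.Ioo (0 : ℝ) 1)
    {x : ℝ} : quantile P Y p ≤ x ↔ p ≤ P.real {ω | Y ω ≤ x} := by
  refine ⟨fun h => ?_, fun h => csInf_le (quantileSet_bddBelow hY hp) h⟩
  have hlim : Tendsto (fun y => P.real {ω | Y ω ≤ y}) (𝓝[>] x) (𝓝 (P.real {ω | Y ω ≤ x})) := by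
    have := ((cdf (P.map Y)).right_continuous x).tendsto.mono_left
      (nhdsWithin_mono x Set.Ioi_subset_Ici_self)
    rw [cdf_map_eq hY] at this
    exact this.congr fun y => cdf_map_eq hY y
  refine ge_of_tendsto hlim ?_
  filter_upwards [self_mem_nhdsWithin] with y hy
  obtain ⟨z, hz, hzy⟩ := exists_lt_of_csInf_lt (quantileSet_nonempty hY hp) (h.trans_lt hy)
  exact le_trans hz (monotone_measureReal_le Y hzy.le)

theorem monotoneOn_quantile {Y : Ω → ℝ} (hY : Measurable Y) :
    MonotoneOn (quantile P Y) (Set.Ioo 0 1) := fun _ hp _ hp' h =>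
  (quantile_le_iff hY hp).2 (h.trans ((quantile_le_iff hY hp').1 le_rfl))

theorem measurable_quantile_comp {Y U : Ω → ℝ} (hY : Measurable Y) (hU : IsUniform P U) :
    Measurable fun ω => quantile P Y (U ω) := measurable_of_Iic fun x => by
  have : (fun ω => quantile P Y (U ω)) ⁻¹' Set.Iic x = U ⁻¹' Set.Iic (P.real {ω | Y ω ≤ x}) := by
    ext ω
    exact quantile_le_iff hY (hU.mem ω)
  rw [this]
  exact hU.measurable measurableSet_Iic

/-- Quantile transform. -/
theorem map_quantile_comp {Y U : Ω → ℝ} (hY : Measurable Y) (hU : IsUniform P U) :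
    P.map (fun ω => quantile P Y (U ω)) = P.map Y := by
  have hQ := measurable_quantile_comp hY hU
  have := Measure.isProbabilityMeasure_map (μ := P) hQ.aemeasurable
  have := Measure.isProbabilityMeasure_map (μ := P) hY.aemeasurable
  refine Measure.eq_of_cdf _ _ (StieltjesFunction.ext fun x => ?_)
  rw [cdf_map_eq hQ, cdf_map_eq hY]
  simp only [quantile_le_iff hY (hU.mem _)]
  exact hU.cdf _ ⟨measureReal_nonneg, measureReal_le_one⟩

/-- Each bound separates with a rational `x`. Below the limit quantile, the limiting distribution
function at `x` is already strictly less than `p`. Above it, continuity supplies a level `p' > p`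
whose quantile is still less than `x`, which turns `p ≤` into `p <`. -/
theorem tendsto_quantile {Y : ℕ → Ω → ℝ} {Z : Ω → ℝ} (hY : ∀ N, Measurable (Y N))
    (hZ : Measurable Z)
    (hcdf : ∀ x : ℚ, Tendsto (fun N => P.real {ω | Y N ω ≤ x}) atTop (𝓝 (P.real {ω | Z ω ≤ x})))
    {p : ℝ} (hp : p ∈ Set.Ioo (0 : ℝ) 1) (hc : ContinuousAt (quantile P Z) p) :
    Tendsto (fun N => quantile P (Y N) p) atTop (𝓝 (quantile P Z p)) := by
  refine tendsto_order.2 ⟨fun a ha => ?_, fun b hb => ?_⟩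
  · obtain ⟨x, hax, hx⟩ := exists_rat_btwn ha
    have h1 : P.real {ω | Z ω ≤ x} < p := not_le.1 fun h => not_le.2 hx ((quantile_le_iff hZ hp).2 h)
    filter_upwards [(hcdf x).eventually (gt_mem_nhds h1)] with N hN
    exact hax.trans (not_le.1 fun h => not_le.2 hN ((quantile_le_iff (hY N) hp).1 h))
  · obtain ⟨x, hx, hxb⟩ := exists_rat_btwn hb
    have h1 : ∀ᶠ p' in 𝓝[>] p, quantile P Z p' < x :=
      (hc.tendsto.mono_left nhdsWithin_le_nhds).eventually (gt_mem_nhds hx)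
    obtain ⟨p', h2, h3⟩ := (h1.and (Ioo_mem_nhdsGT hp.2)).exists
    have h4 : p < P.real {ω | Z ω ≤ x} :=
      h3.1.trans_le ((quantile_le_iff hZ ⟨hp.1.trans h3.1, h3.2⟩).1 h2.le)
    filter_upwards [(hcdf x).eventually (lt_mem_nhds h4)] with N hN
    exact ((quantile_le_iff (hY N) hp).2 hN.le).trans_lt hxb

theorem IsUniform.measure_eq_zero {U : Ω → ℝ} (hU : IsUniform P U) (x : ℝ) :
    P {ω | U ω = x} = 0 := by
  rw [← measureReal_eq_zero_iff]
  by_cases hx : x ∈ Set.Ioo (0 : ℝ) 1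
  · refine le_antisymm (le_of_forall_pos_le_add fun ε hε => ?_) measureReal_nonneg
    -- The cap at `x` keeps `x - δ` in the unit interval, where the distribution function is known.
    set δ := min ε x with hδ
    have hδ0 : 0 < δ := lt_min hε hx.1
    have hδx : δ ≤ x := min_le_right _ _
    have h1 : {ω | U ω = x} ⊆ {ω | U ω ≤ x} \ {ω | U ω ≤ x - δ} := fun ω (hω : U ω = x) =>
      ⟨hω.le, fun h : U ω ≤ x - δ => by linarith⟩
    have h2 : P.real ({ω | U ω ≤ x} \ {ω | U ω ≤ x - δ}) =
        P.real {ω | U ω ≤ x} - P.real {ω | U ω ≤ x - δ} :=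
      measureReal_sdiff (fun ω (hω : U ω ≤ x - δ) => show U ω ≤ x by linarith)
        (measurableSet_le hU.measurable measurable_const)
    have h3 := measureReal_mono (μ := P) h1
    rw [h2, hU.cdf x ⟨hx.1.le, hx.2.le⟩, hU.cdf (x - δ) ⟨by linarith, by linarith [hx.2]⟩] at h3
    linarith [min_le_left ε x]
  · have : {ω | U ω = x} = ∅ := by
      ext ω
      simp only [Set.mem_ofPred_eq, Set.mem_empty_iff_false, iff_false]
      rintro rfl
      exact hx (hU.mem ω)
    rw [this, measureReal_empty]

/-- A monotone function has countably many discontinuities, and `U` charges no point. -/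
theorem IsUniform.ae_continuousAt_quantile {Z U : Ω → ℝ} (hZ : Measurable Z) (hU : IsUniform P U) :
    ∀ᵐ ω ∂P, ContinuousAt (quantile P Z) (U ω) := by
  have hc := (monotoneOn_quantile (P := P) hZ).countable_not_continuousWithinAt
  have h0 : P (⋃ x ∈ {x ∈ Set.Ioo (0 : ℝ) 1 | ¬ContinuousWithinAt (quantile P Z) (Set.Ioo 0 1) x},
      {ω | U ω = x}) = 0 := (measure_biUnion_null_iff hc).2 fun x _ => hU.measure_eq_zero x
  filter_upwards [measure_eq_zero_iff_ae_notMem.1 h0] with ω hω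
  by_contra h
  refine hω (Set.mem_biUnion (x := U ω) ⟨hU.mem ω, fun h' => h ?_⟩ rfl)
  exact h'.continuousAt (Ioo_mem_nhds (hU.mem ω).1 (hU.mem ω).2)

end Quantile

/-! ### Continuity of convex risk measures -/

section Risk

variable {Ω : Type*} [MeasurableSpace Ω] {P : Measure Ω}

/-- **Scheffé's lemma**. -/
theorem tendsto_integral_abs_sub {f : ℕ → Ω → ℝ} {g : Ω → ℝ} (hf : ∀ N, Integrable (f N) P)
    (hg : Integrable g P) (hlim : ∀ᵐ ω ∂P, Tendsto (fun N => f N ω) atTop (𝓝 (g ω)))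
    (hint : Tendsto (fun N => ∫ ω, |f N ω| ∂P) atTop (𝓝 (∫ ω, |g ω| ∂P))) :
    Tendsto (fun N => ∫ ω, |f N ω - g ω| ∂P) atTop (𝓝 0) := by
  have hd : ∀ N, Integrable (fun ω => |f N ω| + |g ω| - |f N ω - g ω|) P := fun N =>
    ((hf N).abs.add hg.abs).sub ((hf N).sub hg).abs
  -- This integrand lies between `0` and `2 * |g|`, so no domination of `f N` is needed.
  have h1 : Tendsto (fun N => ∫ ω, (|f N ω| + |g ω| - |f N ω - g ω|) ∂P) atTop
      (𝓝 (∫ ω, 2 * |g ω| ∂P)) := by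
    refine tendsto_integral_of_dominated_convergence (fun ω => 2 * |g ω|)
      (fun N => (hd N).aestronglyMeasurable) (hg.abs.const_mul 2)
      (fun N => Eventually.of_forall fun ω => ?_) ?_
    · have h2 := abs_sub (f N ω) (g ω)
      have h3 := abs_sub_abs_le_abs_sub (f N ω) (g ω)
      rw [Real.norm_eq_abs, abs_of_nonneg (by linarith)]
      linarith
    · filter_upwards [hlim] with ω hω
      have := (hω.abs.add_const |g ω|).sub (hω.sub_const (g ω)).abs
      simpa [two_mul] using this
  have h2 : ∀ N, ∫ ω, |f N ω - g ω| ∂P =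
      ∫ ω, |f N ω| ∂P + ∫ ω, |g ω| ∂P - ∫ ω, (|f N ω| + |g ω| - |f N ω - g ω|) ∂P := fun N => by
    have h3 : Integrable (fun ω => |f N ω - g ω|) P := ((hf N).sub hg).abs
    rw [integral_sub (f := fun ω => |f N ω| + |g ω|) ((hf N).abs.add hg.abs) h3,
      integral_add (hf N).abs hg.abs]
    ring
  simp only [h2]
  have := (hint.add_const (∫ ω, |g ω| ∂P)).sub h1
  rw [integral_const_mul] at this
  convert this using 2
  ring

/-- Convex risk measures on `L¹` are continuous along sequences converging fast in mean. -/
theorem DivQuot.IsConvexRiskMeasure.tendsto_of_fast {φ : (Ω → ℝ) → ℝ}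
    (hφ : IsConvexRiskMeasure P (L1 P) φ) {Y : ℕ → Ω → ℝ} {Z : Ω → ℝ} (hY : ∀ k, Y k ∈ L1 P)
    (hZ : Z ∈ L1 P) (hfast : ∀ k : ℕ, ((k : ℝ) + 1) * ∫ ω, |Y k ω - Z ω| ∂P ≤ (1 / 2) ^ k) :
    Tendsto (fun k => φ (Y k)) atTop (𝓝 (φ Z)) := by
  have hm : ∀ k : ℕ, Measurable fun ω => ENNReal.ofReal (((k : ℝ) + 1) * |Y k ω - Z ω|) := fun k =>
    ((((hY k).1.sub hZ.1).abs).const_mul _).ennreal_ofReal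
  -- The weights `k + 1` give one integrable `G` with `|Y k - Z| ≤ G / (k + 1)` for all `k`. Hence
  -- `Y k` lies below the convex combination of `Z + G` and `Z` with weight `1 / (k + 1)` on the
  -- former.
  set G : Ω → ℝ≥0∞ := fun ω => ∑' k : ℕ, ENNReal.ofReal (((k : ℝ) + 1) * |Y k ω - Z ω|) with hG
  have hGm : Measurable G := Measurable.tsum hm
  have hGi : ∫⁻ ω, G ω ∂P ≠ ∞ := by
    rw [hG, lintegral_tsum fun k => (hm k).aemeasurable]
    have h1 : ∀ k : ℕ, ∫⁻ ω, ENNReal.ofReal (((k : ℝ) + 1) * |Y k ω - Z ω|) ∂P ≤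
        ENNReal.ofReal ((1 / 2) ^ k) := fun k => by
      have h2 : Integrable (fun ω => ((k : ℝ) + 1) * |Y k ω - Z ω|) P :=
        (((hY k).2.sub hZ.2).abs).const_mul _
      rw [← ofReal_integral_eq_lintegral_ofReal h2
        (Eventually.of_forall fun ω => by positivity), integral_const_mul]
      exact ENNReal.ofReal_le_ofReal (hfast k)
    refine ne_top_of_le_ne_top ?_ (ENNReal.tsum_le_tsum h1)
    rw [← ENNReal.ofReal_tsum_of_nonneg (fun k => by positivity) summable_geometric_two]
    exact ENNReal.ofReal_ne_top
  have hfin := ae_lt_top hGm hGi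
  set W : Ω → ℝ := fun ω => Z ω + (G ω).toReal with hW
  have hWL : W ∈ L1 P := ⟨hZ.1.add hGm.ennreal_toReal,
    hZ.2.add (integrable_toReal_of_lintegral_ne_top hGm.aemeasurable hGi)⟩
  have hdom : ∀ᵐ ω ∂P, ∀ k : ℕ, |Y k ω - Z ω| ≤ 1 / ((k : ℝ) + 1) * (G ω).toReal := by
    filter_upwards [hfin] with ω hω k
    have h1 : ((k : ℝ) + 1) * |Y k ω - Z ω| ≤ (G ω).toReal := by
      rw [← ENNReal.ofReal_le_iff_le_toReal hω.ne]
      exact ENNReal.le_tsum (f := fun k : ℕ => ENNReal.ofReal (((k : ℝ) + 1) * |Y k ω - Z ω|)) k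
    rw [one_div, ← div_eq_inv_mul, le_div_iff₀' (by positivity)]
    exact h1
  set t : ℕ → ℝ := fun k => 1 / ((k : ℝ) + 1) with ht
  have ht01 : ∀ k, t k ∈ Set.Icc (0 : ℝ) 1 := fun k =>
    ⟨by positivity, (div_le_one (by positivity)).2 (by linarith [(Nat.cast_nonneg k : (0 : ℝ) ≤ k)])⟩
  have htlim : Tendsto t atTop (𝓝 0) := tendsto_one_div_add_atTop_nhds_zero_nat
  have hmix : ∀ k, (fun ω => t k * W ω + (1 - t k) * Z ω) ∈ L1 P := fun k =>
    ⟨(hWL.1.const_mul _).add (hZ.1.const_mul _), (hWL.2.const_mul _).add (hZ.2.const_mul _)⟩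
  have hrefl : ∀ k, (fun ω => 2 * Z ω - Y k ω) ∈ L1 P := fun k =>
    ⟨(hZ.1.const_mul _).sub (hY k).1, (hZ.2.const_mul _).sub (hY k).2⟩
  have hup : ∀ k, φ (Y k) ≤ t k * φ W + (1 - t k) * φ Z := fun k => by
    refine (hφ.mono _ (hY k) _ (hmix k) ?_).trans (hφ.convex _ hWL _ hZ _ (ht01 k))
    filter_upwards [hdom] with ω hω
    have := (le_abs_self _).trans (hω k)
    simp only [hW, ht] at this ⊢
    linarith
  have hup' : ∀ k, φ (fun ω => 2 * Z ω - Y k ω) ≤ t k * φ W + (1 - t k) * φ Z := fun k => by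
    refine (hφ.mono _ (hrefl k) _ (hmix k) ?_).trans (hφ.convex _ hWL _ hZ _ (ht01 k))
    filter_upwards [hdom] with ω hω
    have := (neg_le_abs _).trans (hω k)
    simp only [hW, ht] at this ⊢
    linarith
  -- `Z` is the midpoint of `Y k` and its reflection `2 * Z - Y k`, so convexity turns the upper
  -- bound for the reflection into a lower bound for `Y k`.
  have hlow : ∀ k, 2 * φ Z - (t k * φ W + (1 - t k) * φ Z) ≤ φ (Y k) := fun k => by
    have h1 := hφ.convex _ (hY k) _ (hrefl k) (1 / 2) ⟨by norm_num, by norm_num⟩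
    have h2 : (fun ω => 1 / 2 * Y k ω + (1 - 1 / 2) * (2 * Z ω - Y k ω)) = Z := by
      funext ω; ring
    rw [h2] at h1
    linarith [hup' k]
  have hlim : Tendsto (fun k => t k * φ W + (1 - t k) * φ Z) atTop (𝓝 (φ Z)) := by
    have := (htlim.mul_const (φ W)).add ((htlim.const_sub 1).mul_const (φ Z))
    simpa using this
  refine tendsto_of_tendsto_of_tendsto_of_le_of_le ?_ hlim hlow hup
  have := hlim.const_sub (2 * φ Z)
  rwa [two_mul, add_sub_cancel_right, ← two_mul] at this

/-- Convex risk measures on `L¹` are continuous in mean. -/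
theorem DivQuot.IsConvexRiskMeasure.tendsto {φ : (Ω → ℝ) → ℝ}
    (hφ : IsConvexRiskMeasure P (L1 P) φ) {Y : ℕ → Ω → ℝ} {Z : Ω → ℝ} (hY : ∀ k, Y k ∈ L1 P)
    (hZ : Z ∈ L1 P) (hlim : Tendsto (fun k => ∫ ω, |Y k ω - Z ω| ∂P) atTop (𝓝 0)) :
    Tendsto (fun k => φ (Y k)) atTop (𝓝 (φ Z)) := by
  -- Every subsequence has a further one converging fast enough for `tendsto_of_fast`.
  refine tendsto_of_subseq_tendsto fun ns hns => ?_
  have hev : ∀ k : ℕ, ∀ᶠ j in atTop,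
      ((k : ℝ) + 1) * ∫ ω, |Y (ns j) ω - Z ω| ∂P ≤ (1 / 2) ^ k := fun k => by
    have := (hlim.comp hns).const_mul ((k : ℝ) + 1)
    rw [mul_zero] at this
    exact this.eventually (ge_mem_nhds (by positivity))
  obtain ⟨ms, -, hms⟩ := extraction_forall_of_eventually hev
  exact ⟨ms, hφ.tendsto_of_fast (fun k => hY (ns (ms k))) hZ hms⟩

/-- A law-invariant convex risk measure on `L¹` is continuous for convergence in law together with
first absolute moments. -/
theorem DivQuot.IsConvexRiskMeasure.tendsto_of_cdf [IsProbabilityMeasure P] (hP : Atomless P)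
    {φ : (Ω → ℝ) → ℝ} (hφ : IsConvexRiskMeasure P (L1 P) φ) (hlaw : LawInvariant P (L1 P) φ)
    {Y : ℕ → Ω → ℝ} {Z : Ω → ℝ} (hY : ∀ k, Y k ∈ L1 P) (hZ : Z ∈ L1 P)
    (hcdf : ∀ x : ℚ, Tendsto (fun N => P.real {ω | Y N ω ≤ x}) atTop (𝓝 (P.real {ω | Z ω ≤ x})))
    (hint : Tendsto (fun N => ∫ ω, |Y N ω| ∂P) atTop (𝓝 (∫ ω, |Z ω| ∂P))) :
    Tendsto (fun k => φ (Y k)) atTop (𝓝 (φ Z)) := by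
  obtain ⟨U, hU⟩ := hP.exists_isUniform
  have hid : ∀ {V : Ω → ℝ}, V ∈ L1 P → IdentDistrib (fun ω => quantile P V (U ω)) V P P :=
    fun hV => ⟨(measurable_quantile_comp hV.1 hU).aemeasurable, hV.1.aemeasurable,
      map_quantile_comp hV.1 hU⟩
  have hL : ∀ {V : Ω → ℝ}, V ∈ L1 P → (fun ω => quantile P V (U ω)) ∈ L1 P := fun hV =>
    ⟨measurable_quantile_comp hV.1 hU, (hid hV).integrable_iff.2 hV.2⟩
  have hφq : ∀ {V : Ω → ℝ}, V ∈ L1 P → φ (fun ω => quantile P V (U ω)) = φ V := fun hV =>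
    hlaw _ (hL hV) _ hV (map_quantile_comp hV.1 hU)
  have habs : ∀ {V : Ω → ℝ}, V ∈ L1 P → ∫ ω, |quantile P V (U ω)| ∂P = ∫ ω, |V ω| ∂P := fun hV =>
    ((hid hV).comp measurable_abs).integral_eq
  -- Law-invariance lets `Y k` and `Z` be replaced by their quantile functions evaluated at the same
  -- `U`, which turns convergence in law into almost sure convergence.
  have key := hφ.tendsto (fun k => hL (hY k)) (hL hZ)
    (tendsto_integral_abs_sub (fun k => (hL (hY k)).2) (hL hZ).2
      (by
        filter_upwards [hU.ae_continuousAt_quantile hZ.1] with ω hω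
        exact tendsto_quantile (fun k => (hY k).1) hZ.1 hcdf (hU.mem ω) hω)
      (by simpa only [habs (hY _), habs hZ] using hint))
  simpa only [hφq (hY _), hφq hZ] using key

end Risk

/-! ### Semicontinuity of the diversification quotient -/

section Quotient

variable {Ω : Type*} {n : ℕ} {αbar : ℝ≥0∞} {ρ : ℝ → (Ω → ℝ) → ℝ} {α : ℝ}

theorem alphaStar_le_top_level (X : Ω → Fin n → ℝ) : alphaStar αbar ρ α X ≤ αbar :=
  sInf_le (Set.mem_insert _ _)

theorem alphaStar_le {X : Ω → Fin n → ℝ} {β : ℝ} (hβ : β ∈ levels αbar)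
    (h : ρ β (total X) ≤ ∑ i, ρ α (comp X i)) : alphaStar αbar ρ α X ≤ ENNReal.ofReal β :=
  sInf_le (Set.mem_insert_of_mem _ ⟨β, ⟨hβ, h⟩, rfl⟩)

theorem le_alphaStar {X : Ω → Fin n → ℝ} {β : ℝ} (hβ : β ∈ levels αbar)
    (hanti : AntitoneOn (fun β => ρ β (total X)) (levels αbar))
    (h : ∑ i, ρ α (comp X i) < ρ β (total X)) : ENNReal.ofReal β ≤ alphaStar αbar ρ α X := by
  refine le_sInf ?_
  rintro _ (rfl | ⟨γ, ⟨hγ, hle⟩, rfl⟩)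
  · exact hβ.2.le
  · refine ENNReal.ofReal_le_ofReal (le_of_not_gt fun hlt => ?_)
    exact absurd (h.trans_le ((hanti hγ hβ hlt.le).trans hle)) (lt_irrefl _)

theorem lt_of_lt_alphaStar {X : Ω → Fin n → ℝ} {β : ℝ} (hβ : β ∈ levels αbar)
    (h : ENNReal.ofReal β < alphaStar αbar ρ α X) : ∑ i, ρ α (comp X i) < ρ β (total X) :=
  lt_of_not_ge fun hle => absurd (alphaStar_le hβ hle) (not_le.2 h)

theorem lt_of_alphaTilde_lt {X : Ω → Fin n → ℝ} {β : ℝ} (hβ : β ∈ levels αbar)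
    (h : alphaTilde αbar ρ α X < ENNReal.ofReal β) : ρ β (total X) < ∑ i, ρ α (comp X i) :=
  lt_of_not_ge fun hle => not_le.2 h <|
    le_sSup (Set.mem_image_of_mem ENNReal.ofReal (show β ∈ {γ | γ ∈ levels αbar ∧
      ∑ i, ρ α (comp X i) ≤ ρ γ (total X)} from ⟨hβ, hle⟩))

/-- A level with `≥` cannot exceed a level with `≤`: strict decrease would make the inequalities
incompatible. -/
theorem alphaTilde_le_alphaStar {X : Ω → Fin n → ℝ}
    (hanti : StrictAntiOn (fun β => ρ β (total X)) (levels αbar)) :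
    alphaTilde αbar ρ α X ≤ alphaStar αbar ρ α X := by
  refine sSup_le ?_
  rintro _ ⟨β, ⟨hβ, hle⟩, rfl⟩
  refine le_sInf ?_
  rintro _ (rfl | ⟨γ, ⟨hγ, hle'⟩, rfl⟩)
  · exact hβ.2.le
  · refine ENNReal.ofReal_le_ofReal (le_of_not_gt fun hlt => ?_)
    exact absurd ((hanti hγ hβ hlt).trans_le (hle'.trans hle)) (lt_irrefl _)

theorem exists_level_btwn {a b : ℝ≥0∞} (hab : a < b) (hb : b ≤ αbar) :
    ∃ β ∈ levels αbar, a < ENNReal.ofReal β ∧ ENNReal.ofReal β < b := by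
  obtain ⟨r, har, hrb⟩ := ENNReal.lt_iff_exists_nnreal_btwn.1 hab
  have hr : ENNReal.ofReal r = r := ENNReal.ofReal_coe_nnreal
  refine ⟨r, ⟨?_, ?_⟩, ?_, ?_⟩
  · have : (0 : ℝ≥0∞) < r := (zero_le).trans_lt har
    exact_mod_cast this
  · rw [hr]; exact hrb.trans_le hb
  · rwa [hr]
  · rwa [hr]

/-- Pointwise convergence of the risk curves yields semicontinuity of the diversification
quotient. -/
theorem DQ_le_liminf_and_limsup_le {X : Ω → Fin n → ℝ} {R : ℕ → Ω → Fin n → ℝ}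
    (hα : α ∈ levels αbar)
    (htot : ∀ β ∈ levels αbar, Tendsto (fun N => ρ β (total (R N))) atTop (𝓝 (ρ β (total X))))
    (hsum : Tendsto (fun N => ∑ i, ρ α (comp (R N) i)) atTop (𝓝 (∑ i, ρ α (comp X i))))
    (hanti : ∀ᶠ N in atTop, AntitoneOn (fun β => ρ β (total (R N))) (levels αbar)) :
    DQ αbar ρ α X ≤ liminf (fun N => DQ αbar ρ α (R N)) atTop ∧
      limsup (fun N => DQ αbar ρ α (R N)) atTop ≤
        alphaTilde αbar ρ α X / ENNReal.ofReal α := by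
  have hα0 : ENNReal.ofReal α ≠ 0 := (ENNReal.ofReal_pos.2 hα.1).ne'
  constructor
  · refine le_of_forall_lt fun c hc => ?_
    obtain ⟨c', hcc', hc'⟩ := exists_between hc
    refine hcc'.trans_le ?_
    rw [DQ, ENNReal.lt_div_iff_mul_lt (Or.inl hα0) (Or.inl ENNReal.ofReal_ne_top)] at hc'
    obtain ⟨β, hβ, h1, h2⟩ := exists_level_btwn hc' (alphaStar_le_top_level X)
    refine le_liminf_of_le (by isBoundedDefault) ?_
    filter_upwards [hanti, hsum.eventually_lt (htot β hβ) (lt_of_lt_alphaStar hβ h2)] with N h3 h4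
    rw [DQ, ENNReal.le_div_iff_mul_le (Or.inl hα0) (Or.inl ENNReal.ofReal_ne_top)]
    exact h1.le.trans (le_alphaStar hβ h3 h4)
  · refine le_of_forall_gt fun c hc => ?_
    obtain ⟨c', hc', hcc'⟩ := exists_between hc
    refine lt_of_le_of_lt ?_ hcc'
    rw [ENNReal.div_lt_iff (Or.inl hα0) (Or.inl ENNReal.ofReal_ne_top)] at hc'
    refine limsup_le_of_le (by isBoundedDefault) ?_
    -- If the target lies at or beyond `αbar`, the trivial bound `α* ≤ αbar` suffices; otherwise
    -- there is a genuine level strictly between `alphaTilde` and the target.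
    rcases le_or_gt αbar (c' * ENNReal.ofReal α) with h | h
    · exact Eventually.of_forall fun N =>
        ENNReal.div_le_of_le_mul ((alphaStar_le_top_level (R N)).trans h)
    · obtain ⟨β, hβ, h1, h2⟩ := exists_level_btwn hc' h.le
      filter_upwards [(htot β hβ).eventually_lt hsum (lt_of_alphaTilde_lt hβ h1)] with N h3
      exact ENNReal.div_le_of_le_mul ((alphaStar_le hβ h3.le).trans h2.le)

end Quotient

/-! ### Empirical laws and convergence of risk curves -/

section Empirical

variable {Ω : Type*} [MeasurableSpace Ω] {P : Measure Ω} [IsProbabilityMeasure P] {n : ℕ}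

theorem DivQuot.Atomless.realization_spec (hP : Atomless P) (μ : Measure (Fin n → ℝ))
    [IsProbabilityMeasure μ] : Measurable (realization P μ) ∧ P.map (realization P μ) = μ := by
  obtain ⟨U, hU⟩ := hP.exists_isUniform
  exact Classical.epsilon_spec (hU.exists_map_eq μ)

/-- For `N = 0` the empirical law is the zero measure, which no random vector realizes; hence the
shifted index `N + 1` in what follows. -/
theorem isProbabilityMeasure_empiricalLaw {Ω : Type*} (Xs : ℕ → Ω → Fin n → ℝ) {N : ℕ} (hN : 1 ≤ N)
    (ω : Ω) : IsProbabilityMeasure (empiricalLaw Xs N ω) := ⟨by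
  simp only [empiricalLaw, Measure.smul_apply, Measure.finsetSum_apply, measure_univ, smul_eq_mul,
    Finset.sum_const, Finset.card_range, nsmul_eq_mul, mul_one]
  exact ENNReal.inv_mul_cancel (by exact_mod_cast (by omega : N ≠ 0)) (ENNReal.natCast_ne_top N)⟩

theorem integrable_empiricalLaw {Ω : Type*} (Xs : ℕ → Ω → Fin n → ℝ) {N : ℕ} (hN : 1 ≤ N) (ω : Ω)
    {g : (Fin n → ℝ) → ℝ} (hg : Measurable g) : Integrable g (empiricalLaw Xs N ω) :=
  (integrable_finsetSum_measure.2 fun k _ => integrable_dirac' hg.stronglyMeasurable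
    enorm_lt_top).smul_measure
    (ENNReal.inv_ne_top.2 (by exact_mod_cast (by omega : N ≠ 0)))

theorem integral_empiricalLaw {Ω : Type*} (Xs : ℕ → Ω → Fin n → ℝ) (N : ℕ) (ω : Ω)
    {g : (Fin n → ℝ) → ℝ} (hg : Measurable g) :
    ∫ x, g x ∂(empiricalLaw Xs N ω) = (N : ℝ)⁻¹ * ∑ k ∈ Finset.range N, g (Xs k ω) := by
  rw [empiricalLaw, integral_smul_measure, integral_finsetSum_measure fun k _ => integrable_dirac'
    hg.stronglyMeasurable enorm_lt_top]
  simp [integral_dirac' _ _ hg.stronglyMeasurable]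

theorem integrable_realization (hP : Atomless P) (Xs : ℕ → Ω → Fin n → ℝ) {N : ℕ} (hN : 1 ≤ N)
    (ω : Ω) {g : (Fin n → ℝ) → ℝ} (hg : Measurable g) :
    Integrable (fun ω' => g (realization P (empiricalLaw Xs N ω) ω')) P := by
  have := isProbabilityMeasure_empiricalLaw Xs hN ω
  obtain ⟨hR, hRlaw⟩ := hP.realization_spec (empiricalLaw Xs N ω)
  refine (integrable_map_measure hg.aestronglyMeasurable hR.aemeasurable).1 ?_
  rw [hRlaw]
  exact integrable_empiricalLaw Xs hN ω hg

/-- Almost surely, empirical means, computed along realizations of the empirical law, converge. -/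
theorem ae_tendsto_integral_realization (hP : Atomless P) {X : Ω → Fin n → ℝ} (hX : Measurable X)
    {Xs : ℕ → Ω → Fin n → ℝ} (hXs : ∀ k, Measurable (Xs k)) (hlaw : P.map (Xs 0) = P.map X)
    (hstat : Stationary P Xs) (hmix : AlphaMixing P Xs) {g : (Fin n → ℝ) → ℝ} (hg : Measurable g)
    (hgi : Integrable (fun ω => g (X ω)) P) :
    ∀ᵐ ω ∂P, Tendsto (fun N => ∫ ω', g (realization P (empiricalLaw Xs N ω) ω') ∂P) atTop
      (𝓝 (∫ ω', g (X ω') ∂P)) := by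
  have h1 : Integrable g (P.map (Xs 0)) := by
    rw [hlaw]
    exact (integrable_map_measure hg.aestronglyMeasurable hX.aemeasurable).2 hgi
  filter_upwards [ae_tendsto_sampleMean hXs hstat hmix hg h1] with ω hω
  rw [hlaw, integral_map hX.aemeasurable hg.aestronglyMeasurable] at hω
  refine hω.congr' ?_
  filter_upwards [eventually_ge_atTop 1] with N hN
  have := isProbabilityMeasure_empiricalLaw Xs hN ω
  obtain ⟨hR, hRlaw⟩ := hP.realization_spec (empiricalLaw Xs N ω)
  rw [← integral_empiricalLaw Xs N ω hg]
  conv_lhs => rw [← hRlaw]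
  exact integral_map hR.aemeasurable hg.aestronglyMeasurable

/-- The strong law for indicators; restricting to rational thresholds leaves countably many null
sets. -/
theorem ae_tendsto_cdf_realization (hP : Atomless P) {X : Ω → Fin n → ℝ} (hX : Measurable X)
    {Xs : ℕ → Ω → Fin n → ℝ} (hXs : ∀ k, Measurable (Xs k)) (hlaw : P.map (Xs 0) = P.map X)
    (hstat : Stationary P Xs) (hmix : AlphaMixing P Xs) {g : (Fin n → ℝ) → ℝ}
    (hg : Measurable g) :
    ∀ᵐ ω ∂P, ∀ x : ℚ,
      Tendsto (fun N => P.real {ω' | g (realization P (empiricalLaw Xs (N + 1) ω) ω') ≤ x}) atTop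
        (𝓝 (P.real {ω' | g (X ω') ≤ x})) := by
  refine ae_all_iff.2 fun x => ?_
  have hS : MeasurableSet {y : Fin n → ℝ | g y ≤ x} := measurableSet_le hg measurable_const
  have hind : ∀ {Y : Ω → Fin n → ℝ}, Measurable Y →
      ∫ ω', {y : Fin n → ℝ | g y ≤ x}.indicator (fun _ => (1 : ℝ)) (Y ω') ∂P =
        P.real {ω' | g (Y ω') ≤ x} := fun hY => integral_indicator_one (hY hS)
  filter_upwards [ae_tendsto_integral_realization hP hX hXs hlaw hstat hmix
    (g := {y : Fin n → ℝ | g y ≤ x}.indicator fun _ => 1) (measurable_const.indicator hS)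
    ((integrable_const (1 : ℝ)).indicator (hX hS))] with ω hω
  rw [hind hX] at hω
  refine ((tendsto_add_atTop_iff_nat 1).2 hω).congr fun N => ?_
  have := isProbabilityMeasure_empiricalLaw Xs (Nat.le_add_left 1 N) ω
  exact hind (hP.realization_spec (empiricalLaw Xs (N + 1) ω)).1

theorem mem_levels_one {β : ℝ} : β ∈ levels 1 ↔ β ∈ Set.Ioo (0 : ℝ) 1 := by
  simp [levels, ENNReal.ofReal_lt_one]

theorem antitoneOn_VaR {Y : Ω → ℝ} (hY : Measurable Y) :
    AntitoneOn (fun β => VaR P β Y) (levels 1) := fun β hβ γ hγ h => by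
  have hβ := mem_levels_one.1 hβ
  have hγ := mem_levels_one.1 hγ
  exact monotoneOn_quantile (P := P) hY ⟨by linarith [hγ.2], by linarith [hγ.1]⟩
    ⟨by linarith [hβ.2], by linarith [hβ.1]⟩ (by linarith)

/-- The risk curves of the empirical laws are antitone and converge to that of `X`. -/
def RiskCurvesConverge {Ω : Type*} (αbar : ℝ≥0∞) (ρ : ℝ → (Ω → ℝ) → ℝ) (α : ℝ)
    (X : Ω → Fin n → ℝ) (R : ℕ → Ω → Fin n → ℝ) : Prop :=
  (∀ β ∈ levels αbar, Tendsto (fun N => ρ β (total (R N))) atTop (𝓝 (ρ β (total X)))) ∧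
    (∀ i, Tendsto (fun N => ρ α (comp (R N) i)) atTop (𝓝 (ρ α (comp X i)))) ∧
    ∀ N, AntitoneOn (fun β => ρ β (total (R N))) (levels αbar)

theorem DivQuot.IsLawInvariantConvexClass.riskCurvesConverge (hP : Atomless P) {αbar : ℝ≥0∞}
    {ρ : ℝ → (Ω → ℝ) → ℝ} {α : ℝ} (hα : α ∈ levels αbar)
    (hρ : IsLawInvariantConvexClass P (L1 P) αbar ρ) {X : Ω → Fin n → ℝ} {R : ℕ → Ω → Fin n → ℝ}
    (hX : ∀ i, comp X i ∈ L1 P) (hR : ∀ N i, comp (R N) i ∈ L1 P)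
    (hXt : total X ∈ L1 P) (hRt : ∀ N, total (R N) ∈ L1 P)
    (hcdf : ∀ i, ∀ x : ℚ, Tendsto (fun N => P.real {ω | comp (R N) i ω ≤ x}) atTop
      (𝓝 (P.real {ω | comp X i ω ≤ x})))
    (hcdft : ∀ x : ℚ, Tendsto (fun N => P.real {ω | total (R N) ω ≤ x}) atTop
      (𝓝 (P.real {ω | total X ω ≤ x})))
    (hint : ∀ i, Tendsto (fun N => ∫ ω, |comp (R N) i ω| ∂P) atTop (𝓝 (∫ ω, |comp X i ω| ∂P)))
    (hintt : Tendsto (fun N => ∫ ω, |total (R N) ω| ∂P) atTop (𝓝 (∫ ω, |total X ω| ∂P))) :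
    RiskCurvesConverge αbar ρ α X R :=
  ⟨fun β hβ => (hρ.convexRisk β hβ).tendsto_of_cdf hP (hρ.lawInvariant β hβ) hRt hXt hcdft hintt,
    fun i => (hρ.convexRisk α hα).tendsto_of_cdf hP (hρ.lawInvariant α hα) (fun N => hR N i) (hX i)
      (hcdf i) (hint i),
    fun N => hρ.decreasing _ (hRt N)⟩

theorem riskCurvesConverge_VaR {α : ℝ} (hα : α ∈ levels 1) {X : Ω → Fin n → ℝ}
    {R : ℕ → Ω → Fin n → ℝ} (hX : ∀ i, Measurable (comp X i)) (hR : ∀ N i, Measurable (comp (R N) i))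
    (hXt : Measurable (total X)) (hRt : ∀ N, Measurable (total (R N)))
    (hcdf : ∀ i, ∀ x : ℚ, Tendsto (fun N => P.real {ω | comp (R N) i ω ≤ x}) atTop
      (𝓝 (P.real {ω | comp X i ω ≤ x})))
    (hcdft : ∀ x : ℚ, Tendsto (fun N => P.real {ω | total (R N) ω ≤ x}) atTop
      (𝓝 (P.real {ω | total X ω ≤ x})))
    (hci : ∀ i, ContinuousAt (quantile P (comp X i)) (1 - α))
    (hct : ContinuousOn (quantile P (total X)) (Set.Ioo 0 1)) :
    RiskCurvesConverge 1 (VaR P) α X R := by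
  have hsymm : ∀ β ∈ levels 1, 1 - β ∈ Set.Ioo (0 : ℝ) 1 := fun β hβ => by
    have hβ := mem_levels_one.1 hβ
    exact ⟨by linarith [hβ.2], by linarith [hβ.1]⟩
  exact ⟨fun β hβ => tendsto_quantile hRt hXt hcdft (hsymm β hβ)
      (hct.continuousAt (isOpen_Ioo.mem_nhds (hsymm β hβ))),
    fun i => tendsto_quantile (fun N => hR N i) (hX i) (hcdf i) (hsymm α hα) (hci i),
    fun N => antitoneOn_VaR (hRt N)⟩

end Empirical

/-! ### Strong consistency of the estimator -/

theorem proposition4 {Ω : Type*} [MeasurableSpace Ω] (P : Measure Ω) [IsProbabilityMeasure P]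
    (hP : Atomless P) (n : ℕ)
    -- the portfolio and the sample
    (X : Ω → Fin n → ℝ) (hX : Measurable X)
    (Xs : ℕ → Ω → Fin n → ℝ) (hXs : ∀ k, Measurable (Xs k))
    (hlaw : ∀ k, P.map (Xs k) = P.map X)
    (hstat : Stationary P Xs) (hmix : AlphaMixing P Xs) (hsum : MixingSummable P Xs)
    -- the class of risk measures and the level
    (αbar : ℝ≥0∞) (ρ : ℝ → (Ω → ℝ) → ℝ) (α : ℝ) (hα : α ∈ levels αbar)
    (h :
      -- (a) law-invariant convex risk measures on `L¹`
      (IsLawInvariantConvexClass P (L1 P) αbar ρ ∧ ∀ i, comp X i ∈ L1 P) ∨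
      -- (b) Value at Risk, with continuous quantiles
      (αbar = 1 ∧ ρ = VaR P ∧ (∀ i, ContinuousAt (quantile P (comp X i)) (1 - α)) ∧
        ContinuousOn (quantile P (total X)) (Set.Ioo 0 1))) :
    (∀ᵐ ω ∂P,
      DQ αbar ρ α X ≤ liminf (fun N => empiricalDQ P αbar ρ α Xs N ω) atTop ∧
      limsup (fun N => empiricalDQ P αbar ρ α Xs N ω) atTop
        ≤ alphaTilde αbar ρ α X / ENNReal.ofReal α) ∧
    (StrictAntiOn (fun β => ρ β (total X)) (levels αbar) →
      ∀ᵐ ω ∂P,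
        Tendsto (fun N => empiricalDQ P αbar ρ α Xs N ω) atTop (𝓝 (DQ αbar ρ α X))) := by
  have hcm : ∀ i, Measurable fun x : Fin n → ℝ => x i := fun i => measurable_pi_apply i
  have htm : Measurable fun x : Fin n → ℝ => ∑ i, x i := by fun_prop
  have hcdfc : ∀ᵐ ω ∂P, ∀ i, ∀ x : ℚ,
      Tendsto (fun N => P.real {ω' | comp (realization P (empiricalLaw Xs (N + 1) ω)) i ω' ≤ x})
        atTop (𝓝 (P.real {ω' | comp X i ω' ≤ x})) :=
    ae_all_iff.2 fun i => ae_tendsto_cdf_realization hP hX hXs (hlaw 0) hstat hmix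
      (g := fun x => x i) (hcm i)
  have hcdft : ∀ᵐ ω ∂P, ∀ x : ℚ,
      Tendsto (fun N => P.real {ω' | total (realization P (empiricalLaw Xs (N + 1) ω)) ω' ≤ x})
        atTop (𝓝 (P.real {ω' | total X ω' ≤ x})) :=
    ae_tendsto_cdf_realization hP hX hXs (hlaw 0) hstat hmix htm
  -- The exceptional set does not depend on the level `β`: it comes only from the countably many
  -- sample means, whose convergence controls all levels simultaneously.
  have key : ∀ᵐ ω ∂P, RiskCurvesConverge αbar ρ α X
      fun N => realization P (empiricalLaw Xs (N + 1) ω) := by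
    have hR : ∀ N ω, Measurable (realization P (empiricalLaw Xs (N + 1) ω)) := fun N ω => by
      have := isProbabilityMeasure_empiricalLaw Xs (Nat.le_add_left 1 N) ω
      exact (hP.realization_spec (empiricalLaw Xs (N + 1) ω)).1
    have hRc : ∀ N ω i, Measurable (comp (realization P (empiricalLaw Xs (N + 1) ω)) i) :=
      fun N ω i => (hcm i).comp (hR N ω)
    have hRt : ∀ N ω, Measurable (total (realization P (empiricalLaw Xs (N + 1) ω))) :=
      fun N ω => htm.comp (hR N ω)
    rcases h with ⟨hρ, hXi⟩ | ⟨rfl, rfl, hci, hct⟩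
    · have hXt : total X ∈ L1 P := ⟨htm.comp hX, integrable_finsetSum _ fun i _ => (hXi i).2⟩
      have hint : ∀ {g : (Fin n → ℝ) → ℝ}, Measurable g → ∀ N ω,
          Integrable (fun ω' => g (realization P (empiricalLaw Xs (N + 1) ω) ω')) P :=
        fun hg N ω => integrable_realization hP Xs (Nat.le_add_left 1 N) ω hg
      have hmc : ∀ᵐ ω ∂P, ∀ i, Tendsto
          (fun N => ∫ ω', |comp (realization P (empiricalLaw Xs N ω)) i ω'| ∂P) atTop
          (𝓝 (∫ ω', |comp X i ω'| ∂P)) := ae_all_iff.2 fun i =>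
        ae_tendsto_integral_realization hP hX hXs (hlaw 0) hstat hmix
          (g := fun x => |x i|) (hcm i).abs (hXi i).2.abs
      have hmt : ∀ᵐ ω ∂P, Tendsto
          (fun N => ∫ ω', |total (realization P (empiricalLaw Xs N ω)) ω'| ∂P) atTop
          (𝓝 (∫ ω', |total X ω'| ∂P)) :=
        ae_tendsto_integral_realization hP hX hXs (hlaw 0) hstat hmix
          (g := fun x => |∑ i, x i|) htm.abs hXt.2.abs
      filter_upwards [hcdfc, hcdft, hmc, hmt] with ω h1 h2 h3 h4
      exact hρ.riskCurvesConverge hP hα hXi (fun N i => ⟨hRc N ω i, hint (hcm i) N ω⟩) hXt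
        (fun N => ⟨hRt N ω, hint htm N ω⟩) h1 h2
        (fun i => (tendsto_add_atTop_iff_nat 1).2 (h3 i)) ((tendsto_add_atTop_iff_nat 1).2 h4)
    · filter_upwards [hcdfc, hcdft] with ω h1 h2
      exact riskCurvesConverge_VaR hα (fun i => (hcm i).comp hX) (fun N i => hRc N ω i)
        (htm.comp hX) (fun N => hRt N ω) h1 h2 hci hct
  have main : ∀ᵐ ω ∂P,
      DQ αbar ρ α X ≤ liminf (fun N => empiricalDQ P αbar ρ α Xs N ω) atTop ∧
      limsup (fun N => empiricalDQ P αbar ρ α Xs N ω) atTop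
        ≤ alphaTilde αbar ρ α X / ENNReal.ofReal α := by
    filter_upwards [key] with ω hω
    obtain ⟨h1, h2, h3⟩ := hω
    refine DQ_le_liminf_and_limsup_le hα
      (fun β hβ => (tendsto_add_atTop_iff_nat 1).1 (h1 β hβ))
      ((tendsto_add_atTop_iff_nat 1).1 (tendsto_finsetSum _ fun i _ => h2 i)) ?_
    filter_upwards [eventually_ge_atTop 1] with N hN
    obtain ⟨M, rfl⟩ := Nat.exists_eq_add_of_le' hN
    exact h3 M
  refine ⟨main, fun hstrict => ?_⟩
  filter_upwards [main] with ω hω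
  exact tendsto_of_le_liminf_of_limsup_le hω.1
    (hω.2.trans (ENNReal.div_le_div_right (alphaTilde_le_alphaStar hstrict) _))
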